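/- Let $\Omega\subset\mathbb R^3$ be a bounded domain. Let $H$ be the closure in $(L^2)^3$ of the divergence-free fields in $(C_0^\infty)^3$, $P$ the orthogonal projection of $(L^2)^3$ onto $H$, $V=(H^1_0)^3\cap H$, $\|\cdot\|$ the $L^2$ norm, $\|v\|_1=\|\nabla v\|$, $\|h\|_{-1}=\sup\{|(h,\varphi)|:\varphi\in V,\ \|\varphi\|_1\le 1\}$, $A=-P\Delta$ the Stokes operator with no-slip boundary condition, $\lambda_1$ its first eigenvalue, and $B(u,v)=P((u\cdot\nabla)v)$. For $\alpha,\nu,T>0$, $f\in (L^2)^3$ independent of time, $h=Pf$ and $v_0\in V$, let $v\in C([0,T];V)$ be a weak solution (equation in $V'$, tested against all of $V$) of the Navier–Stokes–Voight equations $$v_t+\nu Av+\alpha^2Av_t+B(v,v)=h,\qquad v(0)=v_0,$$ and let $u\in C([0,T];V)$ be a weak solution of the inviscid simplified Bardina model with the same data, $$u_t+\alpha^2Au_t+B(u,u)=h,\qquad u(0)=v_0 .$$ Put $w=v-u$ and $D_T=\alpha^{-2}\big[\|v_0\|^2+\alpha^2\|v_0\|_1^2+T\alpha^{-2}\|h\|_{-1}^2\big]$.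 1. There is a constant $C>0$, depending only on $\Omega$ and the same for all dilates $r\Omega$, $r>0$, of $\Omega$ (in particular independent of $\alpha,\nu,T,f,v_0$ and of the solutions), such that on each domain $r\Omega$, with $\lambda_1=\lambda_1(r\Omega)$, for all such data and solutions and all $t\in[0,T]$, $$\|w(t)\|^2+\alpha^2\|w(t)\|_1^2\le \nu^2\,T D_T e^{T}\exp\!\Big(\alpha^{-2}T+C\alpha^{-2}\lambda_1^{-1/4}\,T\,D_T^{1/2}e^{T/2}\Big).$$ 2. Consequently, for fixed $\alpha,T,f,v_0$, on $\Omega$ the solutions of the Navier–Stokes–Voight equations converge in $V$, uniformly on $[0,T]$, to the solution $u$ of the inviscid simplified Bardina model as $\nu\to0^+$: for every $\varepsilon>0$ there is $\nu_0>0$ such that $\|v(t)-u(t)\|_1<\varepsilon$ for all $t\in[0,T]$ whenever $v$ is a solution with viscosity $\nu\in(0,\nu_0)$. -/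

import Mathlib

open MeasureTheory Set Filter Topology
open scoped Pointwise ContDiff

noncomputable section

namespace NSV

/-- Physical space `ℝ³` with its Euclidean norm. -/
abbrev E3 : Type := EuclideanSpace ℝ (Fin 3)

/-- The `i`-th standard unit vector of `ℝ³`. -/
def unitVec (i : Fin 3) : E3 := EuclideanSpace.single i (1 : ℝ)

/-- The partial derivative `∂ᵢ φ` of a vector field. -/
def partialD (i : Fin 3) (φ : E3 → E3) : E3 → E3 := fun x => fderiv ℝ φ x (unitVec i)

/-- The vector fields in `(C₀^∞(Ω))³`: smooth, with compact support contained in `Ω`. -/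
structure IsTestField (Ω : Set E3) (φ : E3 → E3) : Prop where
  smooth : ContDiff ℝ ∞ φ
  compact_support : HasCompactSupport φ
  support_subset : tsupport φ ⊆ Ω

/-- `∇ · φ = 0` for a smooth vector field. -/
def IsDivFree (φ : E3 → E3) : Prop := ∀ x : E3, ∑ i : Fin 3, partialD i φ x i = 0

/-- `(L²(Ω))³`. -/
abbrev L2 (Ω : Set E3) : Type := Lp E3 2 (volume.restrict Ω)

/-- Pairs `(v, (∂₁v, ∂₂v, ∂₃v))` of an `L²` vector field and its candidate partial derivatives. -/
abbrev L2Jet (Ω : Set E3) : Type := L2 Ω × (Fin 3 → L2 Ω)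

theorem IsTestField.zero (Ω : Set E3) : IsTestField Ω (0 : E3 → E3) where
  smooth := contDiff_const
  compact_support := HasCompactSupport.zero
  support_subset := by simp [tsupport]

theorem IsTestField.add {Ω : Set E3} {φ ψ : E3 → E3} (hφ : IsTestField Ω φ)
    (hψ : IsTestField Ω ψ) : IsTestField Ω (φ + ψ) where
  smooth := hφ.smooth.add hψ.smooth
  compact_support := hφ.compact_support.add hψ.compact_support
  support_subset := (tsupport_add φ ψ).trans
    (union_subset hφ.support_subset hψ.support_subset)

theorem IsTestField.smul {Ω : Set E3} {φ : E3 → E3} (c : ℝ) (hφ : IsTestField Ω φ) :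
    IsTestField Ω (c • φ) where
  smooth := contDiff_const.smul hφ.smooth
  compact_support := hφ.compact_support.smul_left (f := fun _ => c)
  support_subset := (tsupport_smul_subset_right (fun _ => c) φ).trans hφ.support_subset

theorem partialD_add {Ω : Set E3} {φ ψ : E3 → E3} (hφ : IsTestField Ω φ)
    (hψ : IsTestField Ω ψ) (i : Fin 3) :
    partialD i (φ + ψ) = partialD i φ + partialD i ψ := by
  funext x
  have h1 : DifferentiableAt ℝ φ x := (hφ.smooth.differentiable (by simp)) x
  have h2 : DifferentiableAt ℝ ψ x := (hψ.smooth.differentiable (by simp)) x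
  simp [partialD, fderiv_add h1 h2]

theorem partialD_smul {Ω : Set E3} {φ : E3 → E3} (c : ℝ) (hφ : IsTestField Ω φ)
    (i : Fin 3) : partialD i (c • φ) = c • partialD i φ := by
  funext x
  have h1 : DifferentiableAt ℝ φ x := (hφ.smooth.differentiable (by simp)) x
  simp [partialD, fderiv_const_smul h1]

/-- The graph `{(φ, ∇φ) : φ ∈ (C₀^∞(Ω))³}` inside `L² × (L²)³`. -/
def testJets (Ω : Set E3) : Submodule ℝ (L2Jet Ω) where
  carrier := {p | ∃ φ : E3 → E3, IsTestField Ω φ ∧ p.1 =ᵐ[volume.restrict Ω] φ ∧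
    ∀ i, p.2 i =ᵐ[volume.restrict Ω] partialD i φ}
  zero_mem' := ⟨0, IsTestField.zero Ω, Lp.coeFn_zero _ _ _, fun i => by
    have h : partialD i (0 : E3 → E3) = 0 := by funext x; simp [partialD]
    rw [h]
    exact Lp.coeFn_zero _ _ _⟩
  add_mem' := by
    rintro p q ⟨φ, hφ, h1, h2⟩ ⟨ψ, hψ, k1, k2⟩
    refine ⟨φ + ψ, hφ.add hψ, (Lp.coeFn_add _ _).trans (h1.add k1), fun i => ?_⟩
    rw [partialD_add hφ hψ]
    exact (Lp.coeFn_add _ _).trans ((h2 i).add (k2 i))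
  smul_mem' := by
    rintro c p ⟨φ, hφ, h1, h2⟩
    refine ⟨c • φ, hφ.smul c, (Lp.coeFn_smul _ _).trans (h1.const_smul c), fun i => ?_⟩
    rw [partialD_smul c hφ]
    exact (Lp.coeFn_smul _ _).trans ((h2 i).const_smul c)

/-- `(H₀¹(Ω))³`: the closure of `(C₀^∞(Ω))³` in the `H¹` norm. A field `v` is stored together with
its weak gradient, as the pair `(v, ∇v)`; the second entry is determined by the first. -/
def H01 (Ω : Set E3) : Submodule ℝ (L2Jet Ω) := (testJets Ω).topologicalClosure

/-- The set `𝒱` of divergence-free fields in `(C₀^∞(Ω))³`, seen in `(L²(Ω))³`. -/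
def solenoidalTest (Ω : Set E3) : Submodule ℝ (L2 Ω) where
  carrier := {p | ∃ φ : E3 → E3, IsTestField Ω φ ∧ IsDivFree φ ∧
    p =ᵐ[volume.restrict Ω] φ}
  zero_mem' := ⟨0, IsTestField.zero Ω, fun x => by simp [partialD], Lp.coeFn_zero _ _ _⟩
  add_mem' := by
    rintro p q ⟨φ, hφ, dφ, h1⟩ ⟨ψ, hψ, dψ, k1⟩
    refine ⟨φ + ψ, hφ.add hψ, fun x => ?_, (Lp.coeFn_add _ _).trans (h1.add k1)⟩
    have a := dφ x
    have b := dψ x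
    simp only [partialD_add hφ hψ, Pi.add_apply, PiLp.add_apply, Finset.sum_add_distrib, a, b,
      add_zero]
  smul_mem' := by
    rintro c p ⟨φ, hφ, dφ, h1⟩
    refine ⟨c • φ, hφ.smul c, fun x => ?_, (Lp.coeFn_smul _ _).trans (h1.const_smul c)⟩
    have a := dφ x
    simp only [partialD_smul c hφ, Pi.smul_apply, PiLp.smul_apply, smul_eq_mul,
      ← Finset.mul_sum, a, mul_zero]

/-- `H`: the closure of `𝒱` in `(L²(Ω))³`. -/
def H (Ω : Set E3) : Submodule ℝ (L2 Ω) := (solenoidalTest Ω).topologicalClosure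

instance (Ω : Set E3) : CompleteSpace (H Ω) :=
  (solenoidalTest Ω).isClosed_topologicalClosure.completeSpace_coe

/-- The Helmholtz–Leray projection `P`: the orthogonal projection of `(L²(Ω))³` onto `H`. -/
def leray (Ω : Set E3) : L2 Ω →L[ℝ] L2 Ω := (H Ω).starProjection

/-- `V = (H₀¹(Ω))³ ∩ H`, as pairs `(v, ∇v)`, with the `H¹` topology. -/
def V (Ω : Set E3) : Submodule ℝ (L2Jet Ω) :=
  H01 Ω ⊓ (H Ω).comap (LinearMap.fst ℝ (L2 Ω) (Fin 3 → L2 Ω))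

section forms

variable {Ω : Set E3}

/-- The vector field `v ∈ (L²(Ω))³` underlying an element of `V`. -/
def vel (v : V Ω) : L2 Ω := v.1.1

/-- The weak partial derivative `∂ᵢ v ∈ (L²(Ω))³`. -/
def dvel (i : Fin 3) (v : V Ω) : L2 Ω := v.1.2 i

/-- `(∇u, ∇v) = ∑_{i,j} (∂ᵢuⱼ, ∂ᵢvⱼ)`. -/
def gradInner (u v : V Ω) : ℝ := ∑ i : Fin 3, inner ℝ (dvel i u) (dvel i v)

/-- `‖v‖₁ = ‖∇v‖`. -/
def norm1 (v : V Ω) : ℝ := Real.sqrt (gradInner v v)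

/-- `‖h‖₋₁`, the norm of the functional `φ ↦ (h, φ)` on `(V, ‖·‖₁)`. -/
def normNeg1 (h : L2 Ω) : ℝ :=
  sSup {a : ℝ | ∃ φ : V Ω, norm1 φ ≤ 1 ∧ a = |inner ℝ h (vel φ)|}

/-- The trilinear form `b(u, v, w) = ∫_Ω ((u · ∇) v) · w dx`. -/
def trilin (u v w : V Ω) : ℝ :=
  ∫ x in Ω, ∑ i : Fin 3, ∑ j : Fin 3, vel u x i * dvel i v x j * vel w x j

/-- `A w = g` for the Stokes operator `A = -PΔ` with no-slip boundary condition: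
`w ∈ V`, `g ∈ H` and `(∇w, ∇φ) = (g, φ)` for all `φ ∈ V`. -/
def StokesEq (w : V Ω) (g : L2 Ω) : Prop :=
  g ∈ H Ω ∧ ∀ φ : V Ω, gradInner w φ = inner ℝ g (vel φ)

end forms

/-- The eigenvalues of the Stokes operator on `Ω`. -/
def stokesEigenvalues (Ω : Set E3) : Set ℝ :=
  {μ | ∃ w : V Ω, vel w ≠ 0 ∧ StokesEq w (μ • vel w)}

/-- `v` is a weak solution on `[0, T]`, in the class `C([0,T]; V)`, of
`v_t + ν A v + α² A v_t + B(v, v) = P f`, `v(0) = v₀`, the equation being understood in `V'`,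
i.e. tested against every `φ ∈ V`. -/
structure IsNSVSolution (Ω : Set E3) (α ν T : ℝ) (f : L2 Ω) (v₀ : V Ω) (v : ℝ → V Ω) :
    Prop where
  cont : ContinuousOn v (Icc 0 T)
  init : v 0 = v₀
  eqn : ∀ φ : V Ω, ∀ t ∈ Icc (0 : ℝ) T,
    HasDerivWithinAt
      (fun s => inner ℝ (vel (v s)) (vel φ) + α ^ 2 * gradInner (v s) φ)
      (inner ℝ (leray Ω f) (vel φ) - ν * gradInner (v t) φ - trilin (v t) (v t) φ)
      (Icc 0 T) t

/-- `u` is a weak solution on `[0, T]`, in the class `C([0,T]; V)`, of the inviscid simplified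
Bardina model `u_t + α² A u_t + B(u, u) = P f`, `u(0) = v₀`. -/
structure IsBardinaSolution (Ω : Set E3) (α T : ℝ) (f : L2 Ω) (v₀ : V Ω) (u : ℝ → V Ω) :
    Prop where
  cont : ContinuousOn u (Icc 0 T)
  init : u 0 = v₀
  eqn : ∀ φ : V Ω, ∀ t ∈ Icc (0 : ℝ) T,
    HasDerivWithinAt
      (fun s => inner ℝ (vel (u s)) (vel φ) + α ^ 2 * gradInner (u s) φ)
      (inner ℝ (leray Ω f) (vel φ) - trilin (u t) (u t) φ)
      (Icc 0 T) t

/-- `D_T = α⁻² [‖v₀‖² + α² ‖v₀‖₁² + T α⁻² ‖P f‖₋₁²]`. -/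
def DT {Ω : Set E3} (α T : ℝ) (f : L2 Ω) (v₀ : V Ω) : ℝ :=
  (α ^ 2)⁻¹ * (‖vel v₀‖ ^ 2 + α ^ 2 * norm1 v₀ ^ 2
    + T * (α ^ 2)⁻¹ * normNeg1 (leray Ω f) ^ 2)

end NSV

end

/-! Write `w = v - u` and `E = ‖w‖² + α²‖w‖₁²`. Subtracting the two equations and testing with `w`
gives `E' = -2ν(∇v, ∇w) - 2b(w, v, w)`, because `b(v, v, w) - b(u, u, w) = b(w, v, w) + b(u, w, w)`
and the last term vanishes. Young's inequality bounds the viscous term by `ν²‖v‖₁² + ‖w‖₁²`, and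
`‖w‖₁² ≤ α⁻²E`. The Ladyzhenskaya inequality `‖w‖_{L⁴}⁴ ≤ C‖w‖‖w‖₁³` and the Poincaré inequality
`λ₁‖w‖² ≤ ‖w‖₁²` bound the other term by a multiple of `λ₁^{-1/4}‖v‖₁‖w‖₁²`. The energy of `v` alone
gives `‖v‖₁² ≤ D_T e^T` uniformly in `ν`. As `w(0) = 0`, Grönwall's inequality leaves a bound of
order `ν²`.

Three points need care. Solutions are differentiable in time only when paired with a fixed test
field; `hasDerivWithinAt_quadratic` still differentiates the energy. The cancellation `b(a, p, p) =
0` is reached by two density arguments, first in `a ∈ H` and then in `p ∈ H₀¹`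
(`convForm_testJet_self`, `convForm_self_eq_zero`). Finally, the least Stokes eigenvalue must be
shown to be a Poincaré constant (`poincare_of_isLeast`): a minimizer of the Rayleigh quotient exists
by Rellich compactness and is an eigenfunction.

One constant serves all dilates because the Sobolev constant of `ℝ³` does not see the domain, which
enters only through `λ₁`. -/

noncomputable section

namespace NSV

/-! ### Grönwall's inequality and differentiation of the energy -/

/-- A linear form of Grönwall's inequality on `[0, T]`. -/
theorem le_exp_mul_of_deriv_le {T K a : ℝ} {E E' : ℝ → ℝ} (hK : 0 ≤ K) (ha : 0 ≤ a)
    (hE : ∀ t ∈ Icc (0 : ℝ) T, HasDerivWithinAt E (E' t) (Icc 0 T) t)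
    (hle : ∀ t ∈ Icc (0 : ℝ) T, E' t ≤ K * E t + a) :
    ∀ t ∈ Icc (0 : ℝ) T, E t ≤ Real.exp (K * t) * (E 0 + a * t) := by
  intro t ht
  -- With the integrating factor, `exp (-K s) E(s) - a s` is nonincreasing: `E' - K E ≤ a` and `exp
  -- (-K s) ≤ 1`.
  have hder : ∀ s ∈ Icc (0 : ℝ) T, HasDerivWithinAt (fun s => Real.exp (-(K * s)) * E s - a * s)
      (Real.exp (-(K * s)) * (E' s - K * E s) - a) (Icc 0 T) s := by
    intro s hs
    have h1 : HasDerivAt (fun s => Real.exp (-(K * s))) (Real.exp (-(K * s)) * -(K * 1)) s :=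
      (((hasDerivAt_id s).const_mul K).neg).exp
    have h2 := (h1.hasDerivWithinAt.mul (hE s hs)).sub
      (((hasDerivAt_id s).const_mul a).hasDerivWithinAt (s := Icc 0 T))
    exact h2.congr_deriv (by ring)
  have hanti := antitoneOn_of_hasDerivWithinAt_nonpos (convex_Icc (0 : ℝ) T)
    (fun s hs => (hder s hs).continuousWithinAt)
    (fun s hs => (hder s (interior_subset hs)).mono interior_subset)
    (fun s hs => by
      have hs' := interior_subset hs
      have h3 : Real.exp (-(K * s)) ≤ 1 :=
        Real.exp_le_one_iff.2 (neg_nonpos.2 (mul_nonneg hK hs'.1))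
      have h4 : Real.exp (-(K * s)) * (E' s - K * E s) ≤ Real.exp (-(K * s)) * a :=
        mul_le_mul_of_nonneg_left (by linarith [hle s hs']) (Real.exp_pos _).le
      nlinarith)
  have h := hanti ⟨le_rfl, ht.1.trans ht.2⟩ ht ht.1
  simp only [mul_zero, neg_zero, Real.exp_zero, one_mul, sub_zero] at h
  have h5 : Real.exp (-(K * t)) * E t ≤ E 0 + a * t := by linarith
  calc E t = Real.exp (K * t) * (Real.exp (-(K * t)) * E t) := by
        rw [← mul_assoc, ← Real.exp_add]; simp
    _ ≤ _ := mul_le_mul_of_nonneg_left h5 (Real.exp_pos _).le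

/-- If `w` is weakly differentiable with respect to a symmetric positive semidefinite form `B`,
with a uniformly bounded derivative, then `B (w, w)` is differentiable. -/
theorem hasDerivWithinAt_quadratic {E : Type*} [AddCommGroup E] [Module ℝ E]
    (B : LinearMap.BilinForm ℝ E) (hsymm : ∀ x y, B x y = B y x) (hnonneg : ∀ x, 0 ≤ B x x)
    {T M : ℝ} (w : ℝ → E) (g : ℝ → E → ℝ)
    (hw : ∀ φ, ∀ t ∈ Icc (0 : ℝ) T,
      HasDerivWithinAt (fun s => B (w s) φ) (g t φ) (Icc 0 T) t)
    (hg : ∀ t ∈ Icc (0 : ℝ) T, ∀ φ, |g t φ| ≤ M * Real.sqrt (B φ φ))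
    {t : ℝ} (ht : t ∈ Icc (0 : ℝ) T) :
    HasDerivWithinAt (fun s => B (w s) (w s)) (2 * g t (w t)) (Icc 0 T) t := by
  -- Freeze the increment `w s - w t` as the test vector. The mean value inequality then bounds its
  -- square `q` by `M √q |s - t|`; dividing by `√q` shows that `w` is Lipschitz for the seminorm of
  -- `B`.
  have hlip : ∀ s ∈ Icc (0 : ℝ) T, B (w s - w t) (w s - w t) ≤ M ^ 2 * (s - t) ^ 2 := by
    intro s hs
    have h1 := (convex_Icc (0 : ℝ) T).norm_image_sub_le_of_norm_hasDerivWithin_le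
      (hw (w s - w t)) (fun x hx => hg x hx (w s - w t)) ht hs
    simp only [← LinearMap.sub_apply, ← map_sub, Real.norm_eq_abs] at h1
    set q := B (w s - w t) (w s - w t) with hq
    have hq0 : 0 ≤ q := hnonneg _
    rw [abs_of_nonneg hq0] at h1
    have h2 := Real.sq_sqrt hq0
    rcases (Real.sqrt_nonneg q).eq_or_lt with h0 | h0
    · have h4 : q = 0 := by rw [← h2, ← h0]; simp
      rw [h4]
      positivity
    · have h3 : Real.sqrt q ≤ M * |s - t| := by
        have : Real.sqrt q * Real.sqrt q ≤ (M * |s - t|) * Real.sqrt q := by nlinarith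
        exact le_of_mul_le_mul_right this h0
      calc q = Real.sqrt q ^ 2 := h2.symm
        _ ≤ (M * |s - t|) ^ 2 := pow_le_pow_left₀ h0.le h3 2
        _ = _ := by rw [mul_pow, sq_abs]
  have hrem : HasDerivWithinAt (fun s => B (w s - w t) (w s - w t)) 0 (Icc 0 T) t := by
    rw [hasDerivWithinAt_iff_isLittleO]
    have hO : (fun s => B (w s - w t) (w s - w t)) =O[𝓝[Icc 0 T] t] fun s => (s - t) ^ 2 := by
      refine Asymptotics.IsBigO.of_bound (M ^ 2) ?_
      filter_upwards [self_mem_nhdsWithin] with s hs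
      rw [Real.norm_of_nonneg (hnonneg _), Real.norm_of_nonneg (sq_nonneg _)]
      exact hlip s hs
    have ho : (fun s : ℝ => (s - t) ^ 2) =o[𝓝[Icc 0 T] t] fun s => s - t := by
      have h := (Asymptotics.isLittleO_pow_sub_sub t (m := 2) (by norm_num)).mono
        (nhdsWithin_le_nhds (s := Icc (0 : ℝ) T))
      have h' := h.norm_norm
      simpa using (Asymptotics.isLittleO_norm_norm).1 (by simpa using h')
    simpa using hO.trans_isLittleO ho
  -- Expand `B(w s, w s) = 2B(w s, w t) - B(w t, w t) + B(w s - w t, w s - w t)`. Only the first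
  -- term contributes to the derivative, since the last is `O((s - t)²)`.
  have hmain := ((hw (w t) t ht).const_mul 2).sub_const (B (w t) (w t)) |>.add hrem
  refine (hmain.congr_of_mem (fun s _ => ?_) ht).congr_deriv (by ring)
  simp only [map_sub, LinearMap.sub_apply, Pi.add_apply]
  rw [hsymm (w t) (w s)]
  ring

/-! ### Sobolev and Poincaré inequalities in `H₀¹` -/

/-- Interpolation of `L⁴` between `L²` and `L⁶`. -/
theorem eLpNorm_four_sq_le {X F : Type*} [MeasurableSpace X] [NormedAddCommGroup F]
    {μ : Measure X} {f : X → F} (hf : AEStronglyMeasurable f μ) :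
    eLpNorm f 4 μ ^ 4 ≤ eLpNorm f 2 μ * eLpNorm f 6 μ ^ 3 := by
  -- Cauchy–Schwarz applied to `|f|⁴ = |f| · |f|³`.
  have h := ENNReal.lintegral_mul_le_Lp_mul_Lq μ (p := 2) (q := 2) (by
    constructor <;> norm_num) hf.enorm (hf.enorm.pow_const 3)
  have e4 : eLpNorm f 4 μ ^ 4 = ∫⁻ x, ‖f x‖ₑ ^ 4 ∂μ := by
    rw [eLpNorm_eq_lintegral_rpow_enorm_toReal (by norm_num) (by norm_num), ← ENNReal.rpow_natCast,
      ← ENNReal.rpow_mul]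
    norm_num
  have e2 : eLpNorm f 2 μ = (∫⁻ x, ‖f x‖ₑ ^ (2 : ℝ) ∂μ) ^ (1 / (2 : ℝ)) := by
    rw [eLpNorm_eq_lintegral_rpow_enorm_toReal (by norm_num) (by norm_num)]
    norm_num
  have e6 : eLpNorm f 6 μ ^ 3 = (∫⁻ x, (‖f x‖ₑ ^ 3) ^ (2 : ℝ) ∂μ) ^ (1 / (2 : ℝ)) := by
    rw [eLpNorm_eq_lintegral_rpow_enorm_toReal (by norm_num) (by norm_num), ← ENNReal.rpow_natCast,
      ← ENNReal.rpow_mul]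
    norm_num
    congr 1
    exact lintegral_congr fun x => by rw [← pow_mul]
  rw [e4, e2, e6]
  refine le_trans (le_of_eq ?_) h
  exact lintegral_congr fun x => by simp [pow_succ, mul_comm]

theorem fderiv_apply_eq_sum (φ : E3 → E3) (x h : E3) :
    fderiv ℝ φ x h = ∑ i, h i • partialD i φ x := by
  have : h = ∑ i, h i • unitVec i := by
    ext j
    simp [unitVec, Fin.sum_univ_three]
    fin_cases j <;> simp
  conv_lhs => rw [this]
  simp [partialD]

theorem norm_fderiv_le (φ : E3 → E3) (x : E3) :
    ‖fderiv ℝ φ x‖ ≤ ∑ i, ‖partialD i φ x‖ := by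
  refine ContinuousLinearMap.opNorm_le_bound _ (by positivity) fun h => ?_
  rw [fderiv_apply_eq_sum, Finset.sum_mul]
  refine (norm_sum_le _ _).trans (Finset.sum_le_sum fun i _ => ?_)
  rw [norm_smul, mul_comm]
  exact mul_le_mul_of_nonneg_left (PiLp.norm_apply_le h i) (norm_nonneg _)

namespace IsTestField

variable {Ω : Set E3} {φ : E3 → E3}

theorem continuous (hφ : IsTestField Ω φ) : Continuous φ := hφ.smooth.continuous

theorem contDiff_partialD (hφ : IsTestField Ω φ) (i : Fin 3) : ContDiff ℝ ∞ (partialD i φ) :=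
  (hφ.smooth.fderiv_right (m := ∞) (by simp)).clm_apply contDiff_const

theorem continuous_partialD (hφ : IsTestField Ω φ) (i : Fin 3) : Continuous (partialD i φ) :=
  (hφ.contDiff_partialD i).continuous

theorem tsupport_partialD_subset (i : Fin 3) : tsupport (partialD i φ) ⊆ tsupport φ :=
  tsupport_fderiv_apply_subset ℝ (unitVec i)

theorem hasCompactSupport_partialD (hφ : IsTestField Ω φ) (i : Fin 3) :
    HasCompactSupport (partialD i φ) :=
  hφ.compact_support.fderiv_apply ℝ (unitVec i)

theorem memLp (hφ : IsTestField Ω φ) (p : ENNReal) (μ : Measure E3) [IsFiniteMeasureOnCompacts μ] :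
    MemLp φ p μ :=
  hφ.continuous.memLp_of_hasCompactSupport hφ.compact_support

theorem partialD_eq_zero (hφ : IsTestField Ω φ) (i : Fin 3) {x : E3} (hx : x ∉ Ω) :
    partialD i φ x = 0 :=
  image_eq_zero_of_notMem_tsupport fun h =>
    hx (hφ.support_subset (tsupport_partialD_subset i h))

theorem eq_zero (hφ : IsTestField Ω φ) {x : E3} (hx : x ∉ Ω) : φ x = 0 :=
  image_eq_zero_of_notMem_tsupport fun h => hx (hφ.support_subset h)

theorem eLpNorm_fderiv_le (hφ : IsTestField Ω φ) :
    eLpNorm (fderiv ℝ φ) 2 volume ≤ ∑ i, eLpNorm (partialD i φ) 2 (volume.restrict Ω) := by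
  have h1 : eLpNorm (fderiv ℝ φ) 2 volume ≤
      eLpNorm (∑ i : Fin 3, fun x => ‖partialD i φ x‖) 2 volume := by
    refine eLpNorm_mono_real fun x => ?_
    simpa using norm_fderiv_le φ x
  refine h1.trans ((eLpNorm_sum_le (fun i _ =>
    (hφ.continuous_partialD i).norm.aestronglyMeasurable) (by norm_num)).trans
      (Finset.sum_le_sum fun i _ => ?_))
  rw [eLpNorm_norm]
  exact (eLpNorm_restrict_eq_of_support_subset fun x hx =>
    not_not.1 fun h => hx (hφ.partialD_eq_zero i h)).ge

end IsTestField

/-- A Sobolev inequality for test fields passes to `H₀¹`. -/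
theorem eLpNorm_le_of_testField {Ω : Set E3} {q : ENNReal} {S : NNReal}
    (hS : ∀ φ, IsTestField Ω φ → eLpNorm φ q volume ≤ S * eLpNorm (fderiv ℝ φ) 2 volume)
    {p : L2Jet Ω} (hp : p ∈ H01 Ω) :
    eLpNorm p.1 q (volume.restrict Ω) ≤ ENNReal.ofReal (S * ∑ i, ‖p.2 i‖) := by
  obtain ⟨s, hs, hlim⟩ := mem_closure_iff_seq_limit.1 hp
  have hbound : ∀ n, eLpNorm (s n).1 q (volume.restrict Ω) ≤
      ENNReal.ofReal (S * ∑ i, ‖(s n).2 i‖) := by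
    intro n
    obtain ⟨φ, hφ, h1, h2⟩ := hs n
    rw [eLpNorm_congr_ae h1, ENNReal.ofReal_mul S.coe_nonneg, ENNReal.ofReal_coe_nnreal,
      ENNReal.ofReal_sum_of_nonneg fun i _ => norm_nonneg _]
    refine (eLpNorm_mono_measure _ Measure.restrict_le_self).trans ((hS φ hφ).trans ?_)
    refine mul_le_mul_right (hφ.eLpNorm_fderiv_le.trans (Finset.sum_le_sum fun i _ => ?_)) _
    rw [← eLpNorm_congr_ae (h2 i), Lp.norm_def, ENNReal.ofReal_toReal (Lp.eLpNorm_ne_top _)]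
  have h1 : Tendsto (fun n => (s n).1) atTop (𝓝 p.1) := (continuous_fst.tendsto p).comp hlim
  have h2 : Tendsto (fun n => ENNReal.ofReal (S * ∑ i, ‖(s n).2 i‖)) atTop
      (𝓝 (ENNReal.ofReal (S * ∑ i, ‖p.2 i‖))) := by
    have hc : Continuous fun p : L2Jet Ω => ENNReal.ofReal (S * ∑ i, ‖p.2 i‖) :=
      ENNReal.continuous_ofReal.comp (by fun_prop)
    exact (hc.tendsto p).comp hlim
  -- The `L^q` norm need not be continuous along an `L²` limit, but it is lower semicontinuous along
  -- an almost everywhere convergent subsequence (Fatou).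
  obtain ⟨ns, hns, hae⟩ := (tendstoInMeasure_of_tendsto_Lp h1).exists_seq_tendsto_ae
  refine (Lp.eLpNorm_lim_le_liminf_eLpNorm (fun n => Lp.aestronglyMeasurable _) _ hae).trans ?_
  refine (liminf_le_liminf (Eventually.of_forall fun n => hbound (ns n))).trans ?_
  exact (h2.comp hns.tendsto_atTop).liminf_eq.le

theorem finrank_E3 : Module.finrank ℝ E3 = 3 := by simp

/-- The Sobolev inequality `‖v‖_{L⁶} ≤ S ‖∇v‖` in `H₀¹`, with a constant independent of the
domain. -/
theorem exists_eLpNorm_six_le : ∃ S : NNReal, ∀ (Ω : Set E3) (p : L2Jet Ω), p ∈ H01 Ω →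
    eLpNorm p.1 6 (volume.restrict Ω) ≤ ENNReal.ofReal (S * ∑ i, ‖p.2 i‖) := by
  refine ⟨SNormLESNormFDerivOfEqConst E3 (volume : Measure E3) 2, fun Ω p hp =>
    eLpNorm_le_of_testField (fun φ hφ => ?_) hp⟩
  -- The critical exponent in dimension three: `1/6 = 1/2 - 1/3`.
  have := eLpNorm_le_eLpNorm_fderiv_of_eq (F := E3) (volume : Measure E3) (p := 2) (p' := 6)
    (hφ.smooth.of_le (by simp)) hφ.compact_support (by norm_num) (by rw [finrank_E3]; norm_num)
    (by rw [finrank_E3]; norm_num)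
  exact_mod_cast this

/-- The Poincaré inequality in `H₀¹` of a bounded set. -/
theorem exists_norm_fst_le {Ω : Set E3} (hΩ : Bornology.IsBounded Ω) : ∃ K : NNReal,
    ∀ p ∈ H01 Ω, ‖p.1‖ ≤ K * ∑ i, ‖p.2 i‖ := by
  refine ⟨eLpNormLESNormFDerivOfLeConst E3 volume Ω 2 2, fun p hp => ?_⟩
  rw [Lp.norm_def]
  refine ENNReal.toReal_le_of_le_ofReal (by positivity) ?_
  refine eLpNorm_le_of_testField (fun φ hφ => ?_) hp
  have := eLpNorm_le_eLpNorm_fderiv (F := E3) (volume : Measure E3) (p := 2)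
    (hφ.smooth.of_le (by simp)) ((subset_tsupport φ).trans hφ.support_subset) (by norm_num)
    (by rw [finrank_E3]; norm_num) hΩ
  exact_mod_cast this

instance : ENNReal.HolderTriple 4 4 2 where
  inv_add_inv_eq_inv := by
    rw [← two_mul, show (4 : ENNReal) = 2 * 2 by norm_num,
      ENNReal.mul_inv (by simp) (by simp), ← mul_assoc, ENNReal.mul_inv_cancel (by simp) (by simp),
      one_mul]

/-! ### The convective form on `L⁴ × L² × L⁴` -/

/-- The trilinear form on fields: `∫_Ω ∑ᵢ aᵢ (dᵢ · c)`. -/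
def convForm {Ω : Set E3} (a : L2 Ω) (d : Fin 3 → L2 Ω) (c : L2 Ω) : ℝ :=
  ∫ x in Ω, ∑ i, a x i * inner ℝ (d i x) (c x)

theorem trilin_eq_convForm {Ω : Set E3} (u v w : V Ω) :
    trilin u v w = convForm u.1.1 v.1.2 w.1.1 := by
  unfold trilin convForm
  congr 1
  funext x
  refine Finset.sum_congr rfl fun i _ => ?_
  simp only [PiLp.inner_apply, Finset.mul_sum, vel, dvel]
  refine Finset.sum_congr rfl fun j _ => ?_
  simp only [RCLike.inner_apply, conj_trivial]
  ring

/-- The `L⁴` norm of a field. -/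
def norm4 {Ω : Set E3} (a : L2 Ω) : ℝ := (eLpNorm a 4 (volume.restrict Ω)).toReal

theorem norm4_nonneg {Ω : Set E3} (a : L2 Ω) : 0 ≤ norm4 a := ENNReal.toReal_nonneg

section convForm

variable {Ω : Set E3} {a a' c c' : L2 Ω} {d d' : Fin 3 → L2 Ω}

theorem eLpNorm_convTerm_le (a c d : L2 Ω) (i : Fin 3) :
    eLpNorm (fun x => a x i * inner ℝ (d x) (c x)) 1 (volume.restrict Ω) ≤
      eLpNorm a 4 (volume.restrict Ω) * eLpNorm c 4 (volume.restrict Ω) *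
        eLpNorm d 2 (volume.restrict Ω) := by
  have ha := Lp.aestronglyMeasurable a
  have hc := Lp.aestronglyMeasurable c
  have hd := Lp.aestronglyMeasurable d
  calc eLpNorm (fun x => a x i * inner ℝ (d x) (c x)) 1 (volume.restrict Ω)
      ≤ eLpNorm ((fun x => ‖a x‖ * ‖c x‖) • fun x => ‖d x‖) 1 (volume.restrict Ω) := by
        refine eLpNorm_mono_real fun x => ?_
        rw [norm_mul]
        calc ‖a x i‖ * ‖inner ℝ (d x) (c x)‖ ≤ ‖a x‖ * (‖d x‖ * ‖c x‖) :=
              mul_le_mul (PiLp.norm_apply_le _ i) (norm_inner_le_norm _ _) (norm_nonneg _)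
                (norm_nonneg _)
          _ = _ := by simp only [Pi.smul_apply', smul_eq_mul]; ring
    _ ≤ eLpNorm (fun x => ‖a x‖ * ‖c x‖) 2 (volume.restrict Ω) *
        eLpNorm (fun x => ‖d x‖) 2 (volume.restrict Ω) :=
      eLpNorm_smul_le_mul_eLpNorm hd.norm (ha.norm.mul hc.norm)
    _ ≤ _ := by
      rw [eLpNorm_norm]
      gcongr
      have := eLpNorm_smul_le_mul_eLpNorm (p := 4) (q := 4) (r := 2) hc.norm ha.norm
      rwa [eLpNorm_norm, eLpNorm_norm] at this

theorem integrable_convTerm (ha : MemLp a 4 (volume.restrict Ω))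
    (hc : MemLp c 4 (volume.restrict Ω)) (d : L2 Ω) (i : Fin 3) :
    Integrable (fun x => a x i * inner ℝ (d x) (c x)) (volume.restrict Ω) := by
  rw [← memLp_one_iff_integrable]
  refine ⟨?_, (eLpNorm_convTerm_le a c d i).trans_lt ?_⟩
  · exact ((EuclideanSpace.proj (𝕜 := ℝ) i).continuous.comp_aestronglyMeasurable ha.1).mul
      ((Lp.aestronglyMeasurable d).inner hc.1)
  · exact ENNReal.mul_lt_top (ENNReal.mul_lt_top ha.2 hc.2) (Lp.eLpNorm_lt_top d)

theorem integrable_convForm (ha : MemLp a 4 (volume.restrict Ω))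
    (hc : MemLp c 4 (volume.restrict Ω)) (d : Fin 3 → L2 Ω) :
    Integrable (fun x => ∑ i, a x i * inner ℝ (d i x) (c x)) (volume.restrict Ω) :=
  integrable_finsetSum _ fun i _ => integrable_convTerm ha hc (d i) i

theorem abs_convForm_le (ha : MemLp a 4 (volume.restrict Ω))
    (hc : MemLp c 4 (volume.restrict Ω)) (d : Fin 3 → L2 Ω) :
    |convForm a d c| ≤ norm4 a * norm4 c * ∑ i, ‖d i‖ := by
  unfold convForm
  rw [integral_finsetSum _ fun i _ => integrable_convTerm ha hc (d i) i, Finset.mul_sum]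
  refine (Finset.abs_sum_le_sum_abs _ _).trans (Finset.sum_le_sum fun i _ => ?_)
  rw [norm4, norm4, Lp.norm_def, ← ENNReal.toReal_mul, ← ENNReal.toReal_mul, ← Real.norm_eq_abs,
    ← toReal_enorm]
  refine ENNReal.toReal_mono
    (ENNReal.mul_lt_top (ENNReal.mul_lt_top ha.2 hc.2) (Lp.eLpNorm_lt_top (d i))).ne ?_
  refine (enorm_integral_le_lintegral_enorm _).trans ?_
  rw [← eLpNorm_one_eq_lintegral_enorm]
  exact eLpNorm_convTerm_le a c (d i) i

theorem convForm_sub_left (ha : MemLp a 4 (volume.restrict Ω))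
    (ha' : MemLp a' 4 (volume.restrict Ω)) (hc : MemLp c 4 (volume.restrict Ω)) :
    convForm (a - a') d c = convForm a d c - convForm a' d c := by
  unfold convForm
  rw [← integral_sub (integrable_convForm ha hc d) (integrable_convForm ha' hc d)]
  refine integral_congr_ae ?_
  filter_upwards [Lp.coeFn_sub a a'] with x hx
  simp only [hx, Pi.sub_apply, PiLp.sub_apply, sub_mul, Finset.sum_sub_distrib]

theorem convForm_sub_middle (ha : MemLp a 4 (volume.restrict Ω))
    (hc : MemLp c 4 (volume.restrict Ω)) :
    convForm a (d - d') c = convForm a d c - convForm a d' c := by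
  unfold convForm
  rw [← integral_sub (integrable_convForm ha hc d) (integrable_convForm ha hc d')]
  refine integral_congr_ae ?_
  filter_upwards [ae_all_iff.2 fun i => Lp.coeFn_sub (d i) (d' i)] with x hx
  simp only [Pi.sub_apply] at hx
  simp only [Pi.sub_apply, hx, inner_sub_left, mul_sub, Finset.sum_sub_distrib]

theorem convForm_sub_right (ha : MemLp a 4 (volume.restrict Ω))
    (hc : MemLp c 4 (volume.restrict Ω)) (hc' : MemLp c' 4 (volume.restrict Ω)) :
    convForm a d (c - c') = convForm a d c - convForm a d c' := by
  unfold convForm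
  rw [← integral_sub (integrable_convForm ha hc d) (integrable_convForm ha hc' d)]
  refine integral_congr_ae ?_
  filter_upwards [Lp.coeFn_sub c c'] with x hx
  simp only [hx, Pi.sub_apply, inner_sub_right, mul_sub, Finset.sum_sub_distrib]

end convForm

/-! ### The cancellation `b(a, φ, φ) = 0` for test fields -/

section antisymmetry

variable {Ω : Set E3}

theorem hasFDerivAt_coord {ψ : E3 → E3} (hψ : IsTestField Ω ψ) (i : Fin 3) (x : E3) :
    HasFDerivAt (fun y => ψ y i) ((EuclideanSpace.proj (𝕜 := ℝ) i).comp (fderiv ℝ ψ x)) x :=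
  (EuclideanSpace.proj (𝕜 := ℝ) i).hasFDerivAt.comp x
    (hψ.smooth.differentiable (by simp) x).hasFDerivAt

/-- Since `∂ᵢφ · φ = ∂ᵢ(|φ|²/2)`, integrating by parts moves the derivatives onto `ψ`, where they
add up to its divergence. -/
theorem integral_conv_test_eq_zero {φ ψ : E3 → E3} (hψ : IsTestField Ω ψ) (hdiv : IsDivFree ψ)
    (hφ : IsTestField Ω φ) : ∫ x, ∑ i, ψ x i * inner ℝ (partialD i φ x) (φ x) = 0 := by
  have hψi : ∀ i, Continuous fun x => ψ x i := fun i =>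
    (EuclideanSpace.proj (𝕜 := ℝ) i).continuous.comp hψ.continuous
  have hDψi : ∀ i, Continuous fun x => partialD i ψ x i := fun i =>
    (EuclideanSpace.proj (𝕜 := ℝ) i).continuous.comp (hψ.continuous_partialD i)
  have hsψ : ∀ i, HasCompactSupport fun x => ψ x i := fun i =>
    hψ.compact_support.comp_left (g := fun y : E3 => y i) rfl
  have hsDψ : ∀ i, HasCompactSupport fun x => partialD i ψ x i := fun i =>
    (hψ.hasCompactSupport_partialD i).comp_left (g := fun y : E3 => y i) rfl
  have hint : ∀ i, Integrable fun x => ψ x i * inner ℝ (partialD i φ x) (φ x) := fun i =>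
    ((hψi i).mul ((hφ.continuous_partialD i).inner hφ.continuous)).integrable_of_hasCompactSupport
      (hsψ i).mul_right
  have hint' : ∀ i, Integrable fun x => partialD i ψ x i * (inner ℝ (φ x) (φ x) / 2) := fun i =>
    ((hDψi i).mul ((hφ.continuous.inner hφ.continuous).div_const 2)).integrable_of_hasCompactSupport
      (hsDψ i).mul_right
  have hparts : ∀ i, ∫ x, ψ x i * inner ℝ (partialD i φ x) (φ x) =
      -∫ x, partialD i ψ x i * (inner ℝ (φ x) (φ x) / 2) := by
    intro i
    have hg : ∀ x, HasFDerivAt (fun y => inner ℝ (φ y) (φ y) / 2)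
        ((2 : ℝ)⁻¹ • ((fderivInnerCLM ℝ (φ x, φ x)).comp
          ((fderiv ℝ φ x).prod (fderiv ℝ φ x)))) x := by
      intro x
      have h := (hφ.smooth.differentiable (by simp) x).hasFDerivAt
      simpa [div_eq_inv_mul] using (h.inner ℝ h).const_mul (2 : ℝ)⁻¹
    have hgv : ∀ x, ((2 : ℝ)⁻¹ • ((fderivInnerCLM ℝ (φ x, φ x)).comp
          ((fderiv ℝ φ x).prod (fderiv ℝ φ x)))) (unitVec i) =
        inner ℝ (partialD i φ x) (φ x) := by
      intro x
      simp only [smul_apply, ContinuousLinearMap.comp_apply,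
        ContinuousLinearMap.prod_apply, fderivInnerCLM_apply, smul_eq_mul, partialD]
      rw [real_inner_comm (φ x)]
      ring
    have := integral_bilinear_hasFDerivAt_right_eq_neg_left_of_integrable (μ := volume)
      (B := ContinuousLinearMap.mul ℝ ℝ) (v := unitVec i)
      (f := fun x => ψ x i) (g := fun y => inner ℝ (φ y) (φ y) / 2)
      (f' := fun x => (EuclideanSpace.proj (𝕜 := ℝ) i).comp (fderiv ℝ ψ x))
      (g' := fun x => (2 : ℝ)⁻¹ • ((fderivInnerCLM ℝ (φ x, φ x)).comp
          ((fderiv ℝ φ x).prod (fderiv ℝ φ x))))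
      (hint' i) (by simpa only [hgv] using! hint i)
      (((hψi i).mul ((hφ.continuous.inner hφ.continuous).div_const 2)).integrable_of_hasCompactSupport
        (hsψ i).mul_right)
      (fun x _ => hasFDerivAt_coord hψ i x) (fun x _ => hg x)
    simpa only [hgv] using! this
  rw [integral_finsetSum _ fun i _ => hint i]
  simp only [hparts]
  rw [Finset.sum_neg_distrib, ← integral_finsetSum _ fun i _ => hint' i]
  simp only [← Finset.sum_mul, hdiv _, zero_mul, integral_zero, neg_zero]

/-- `b(a, φ, φ) = 0` for `a ∈ H` and a test field `φ`. -/
theorem convForm_testJet_self {a : L2 Ω} (ha : a ∈ H Ω) {q : L2Jet Ω} (hq : q ∈ testJets Ω) :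
    convForm a q.2 q.1 = 0 := by
  obtain ⟨φ, hφ, h1, h2⟩ := hq
  -- For fixed `φ` the form is the `L²` pairing of `b` with the field `h = (∂ᵢφ · φ)ᵢ`. It is
  -- therefore `L²`-continuous in `b`, and its vanishing passes from solenoidal test fields to their
  -- closure `H`.
  set h : E3 → E3 := fun x => WithLp.toLp 2 fun i => inner ℝ (partialD i φ x) (φ x) with hdef
  have hcont : Continuous h := (PiLp.continuous_toLp 2 _).comp
    (continuous_pi fun i => (hφ.continuous_partialD i).inner hφ.continuous)
  have hsupp : HasCompactSupport h := by
    refine hφ.compact_support.mono fun x hx hx0 => hx ?_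
    ext i
    simp [hdef, hx0]
  have hmem : MemLp h 2 (volume.restrict Ω) := hcont.memLp_of_hasCompactSupport hsupp
  have key : ∀ b : L2 Ω, inner ℝ (hmem.toLp h) b =
      ∫ x in Ω, ∑ i, b x i * inner ℝ (partialD i φ x) (φ x) := by
    intro b
    rw [L2.inner_def]
    refine integral_congr_ae ?_
    filter_upwards [hmem.coeFn_toLp] with x hx
    rw [hx, PiLp.inner_apply]
    simp [hdef]
  have hconv : ∀ b : L2 Ω, convForm b q.2 q.1 = inner ℝ (hmem.toLp h) b := by
    intro b
    rw [key]
    refine integral_congr_ae ?_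
    filter_upwards [h1, ae_all_iff.2 h2] with x hx1 hx2
    simp only [hx1, hx2]
  rw [hconv]
  have hclosed : IsClosed {b : L2 Ω | inner ℝ (hmem.toLp h) b = 0} :=
    isClosed_eq (by fun_prop) continuous_const
  refine closure_minimal ?_ hclosed ha
  rintro b ⟨ψ, hψ, hdiv, hb⟩
  rw [mem_ofPred_eq, key, ← integral_conv_test_eq_zero hψ hdiv hφ,
    ← setIntegral_eq_integral_of_forall_compl_eq_zero (μ := volume) (s := Ω)
      (f := fun x => ∑ i, ψ x i * inner ℝ (partialD i φ x) (φ x))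
      fun x hx => by simp [hψ.eq_zero hx]]
  refine integral_congr_ae ?_
  filter_upwards [hb] with x hx
  rw [hx]

end antisymmetry

/-! ### The Hilbert structure of `V` and the energy form -/

section gradient

variable {Ω : Set E3}

/-- The gradient of `v ∈ V` as an element of the Hilbert space `(L²)^{3×3}`. -/
def grad (v : V Ω) : PiLp 2 (fun _ : Fin 3 => L2 Ω) := WithLp.toLp 2 v.1.2

theorem gradInner_eq_inner (u v : V Ω) : gradInner u v = inner ℝ (grad u) (grad v) := by
  rw [PiLp.inner_apply]
  rfl

theorem norm1_eq_norm_grad (v : V Ω) : norm1 v = ‖grad v‖ := by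
  rw [norm1, gradInner_eq_inner, real_inner_self_eq_norm_sq, Real.sqrt_sq (norm_nonneg _)]

theorem norm1_nonneg (v : V Ω) : 0 ≤ norm1 v := Real.sqrt_nonneg _

theorem gradInner_self (v : V Ω) : gradInner v v = norm1 v ^ 2 := by
  rw [norm1_eq_norm_grad, gradInner_eq_inner, real_inner_self_eq_norm_sq]

theorem abs_gradInner_le (u v : V Ω) : |gradInner u v| ≤ norm1 u * norm1 v := by
  rw [gradInner_eq_inner, norm1_eq_norm_grad, norm1_eq_norm_grad]
  exact abs_real_inner_le_norm _ _

theorem grad_add (u v : V Ω) : grad (u + v) = grad u + grad v := rfl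

theorem grad_smul (c : ℝ) (v : V Ω) : grad (c • v) = c • grad v := rfl

theorem vel_add (u v : V Ω) : vel (u + v) = vel u + vel v := rfl

theorem vel_smul (c : ℝ) (v : V Ω) : vel (c • v) = c • vel v := rfl

theorem norm1_smul (c : ℝ) (v : V Ω) : norm1 (c • v) = |c| * norm1 v := by
  rw [norm1_eq_norm_grad, norm1_eq_norm_grad, grad_smul, norm_smul, Real.norm_eq_abs]

theorem continuous_vel : Continuous (vel : V Ω → L2 Ω) :=
  continuous_fst.comp continuous_subtype_val

theorem continuous_grad : Continuous (grad : V Ω → PiLp 2 (fun _ : Fin 3 => L2 Ω)) :=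
  (PiLp.continuous_toLp 2 _).comp (continuous_snd.comp continuous_subtype_val)

theorem continuous_norm1 : Continuous (norm1 : V Ω → ℝ) := by
  have : (norm1 : V Ω → ℝ) = fun v => ‖grad v‖ := funext norm1_eq_norm_grad
  rw [this]
  exact continuous_grad.norm

/-- Cauchy–Schwarz would give the factor `√3`; `2` is a convenient rounding. -/
theorem sum_norm_snd_le (v : V Ω) : ∑ i, ‖v.1.2 i‖ ≤ 2 * norm1 v := by
  have h : norm1 v ^ 2 = ∑ i, ‖v.1.2 i‖ ^ 2 := by
    rw [norm1_eq_norm_grad, PiLp.norm_sq_eq_of_L2]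
    rfl
  have h0 := norm1_nonneg v
  rw [Fin.sum_univ_three] at h ⊢
  refine abs_le_of_sq_le_sq' ?_ (by positivity) |>.2
  nlinarith [sq_nonneg (‖v.1.2 0‖ - ‖v.1.2 1‖), sq_nonneg (‖v.1.2 0‖ - ‖v.1.2 2‖),
    sq_nonneg (‖v.1.2 1‖ - ‖v.1.2 2‖), sq_nonneg (norm1 v)]

/-- The inner product `(u, v) + α² (∇u, ∇v)` on `V`. -/
def alphaForm (Ω : Set E3) (α : ℝ) : LinearMap.BilinForm ℝ (V Ω) :=
  LinearMap.mk₂ ℝ (fun u v => inner ℝ (vel u) (vel v) + α ^ 2 * gradInner u v)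
    (fun u u' v => by
      simp only [gradInner_eq_inner, grad_add, vel_add, inner_add_left]; ring)
    (fun c u v => by
      simp only [gradInner_eq_inner, grad_smul, vel_smul, real_inner_smul_left, smul_eq_mul]; ring)
    (fun u v v' => by
      simp only [gradInner_eq_inner, grad_add, vel_add, inner_add_right]; ring)
    (fun c u v => by
      simp only [gradInner_eq_inner, grad_smul, vel_smul, real_inner_smul_right, smul_eq_mul]; ring)

theorem alphaForm_apply (α : ℝ) (u v : V Ω) :
    alphaForm Ω α u v = inner ℝ (vel u) (vel v) + α ^ 2 * gradInner u v := rfl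

theorem alphaForm_self (α : ℝ) (v : V Ω) :
    alphaForm Ω α v v = ‖vel v‖ ^ 2 + α ^ 2 * norm1 v ^ 2 := by
  rw [alphaForm_apply, gradInner_self, real_inner_self_eq_norm_sq]

theorem alphaForm_comm (α : ℝ) (u v : V Ω) : alphaForm Ω α u v = alphaForm Ω α v u := by
  simp only [alphaForm_apply, gradInner_eq_inner, real_inner_comm]

theorem alphaForm_self_nonneg (α : ℝ) (v : V Ω) : 0 ≤ alphaForm Ω α v v := by
  rw [alphaForm_self]
  positivity

theorem norm_vel_le_sqrt (α : ℝ) (v : V Ω) : ‖vel v‖ ≤ Real.sqrt (alphaForm Ω α v v) := by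
  refine Real.le_sqrt_of_sq_le ?_
  rw [alphaForm_self]
  nlinarith [sq_nonneg (α * norm1 v)]

theorem norm1_le_sqrt {α : ℝ} (hα : 0 < α) (v : V Ω) :
    norm1 v ≤ α⁻¹ * Real.sqrt (alphaForm Ω α v v) := by
  rw [le_inv_mul_iff₀ hα]
  refine Real.le_sqrt_of_sq_le ?_
  rw [alphaForm_self]
  nlinarith [sq_nonneg ‖vel v‖]

end gradient

/-! ### Ladyzhenskaya inequalities -/

section ladyzhenskaya

theorem memLp_four {Ω : Set E3} {p : L2Jet Ω} (hp : p ∈ H01 Ω) :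
    MemLp p.1 4 (volume.restrict Ω) := by
  obtain ⟨S, hS⟩ := exists_eLpNorm_six_le
  refine ⟨Lp.aestronglyMeasurable _, ?_⟩
  have h := eLpNorm_four_sq_le (Lp.aestronglyMeasurable p.1)
  have h6 := (hS Ω p hp).trans_lt ENNReal.ofReal_lt_top
  by_contra hcon
  rw [not_lt, top_le_iff] at hcon
  rw [hcon, ENNReal.top_pow (by norm_num), top_le_iff] at h
  exact ENNReal.mul_ne_top (Lp.eLpNorm_ne_top _) (ENNReal.pow_ne_top h6.ne) h

/-- The Ladyzhenskaya inequality in `H₀¹`, with a constant independent of the domain. -/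
theorem exists_norm4_le : ∃ S : ℝ, 0 ≤ S ∧ ∀ (Ω : Set E3) (p : L2Jet Ω), p ∈ H01 Ω →
    norm4 p.1 ^ 4 ≤ ‖p.1‖ * (S * ∑ i, ‖p.2 i‖) ^ 3 := by
  obtain ⟨S, hS⟩ := exists_eLpNorm_six_le
  refine ⟨S, S.coe_nonneg, fun Ω p hp => ?_⟩
  have h0 : 0 ≤ S * ∑ i, ‖p.2 i‖ := by positivity
  have h := (eLpNorm_four_sq_le (Lp.aestronglyMeasurable p.1)).trans
    (mul_le_mul_right (pow_le_pow_left' (hS Ω p hp) 3) _)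
  have h2 := ENNReal.toReal_mono (ENNReal.mul_ne_top (Lp.eLpNorm_ne_top p.1)
    (ENNReal.pow_ne_top ENNReal.ofReal_ne_top)) h
  rwa [ENNReal.toReal_mul, ENNReal.toReal_pow, ENNReal.toReal_pow, ENNReal.toReal_ofReal h0,
    ← Lp.norm_def] at h2

/-- This is the `L⁴` continuity used to pass to limits in `H₀¹`. The factor `3` counts the partial
derivatives, each bounded by the sup norm of the jet; adding `1` makes the constant at least `1`, so
that no fourth root is needed. -/
theorem exists_norm4_le_norm : ∃ K : ℝ, 0 ≤ K ∧ ∀ (Ω : Set E3) (p : L2Jet Ω), p ∈ H01 Ω →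
    norm4 p.1 ≤ K * ‖p‖ := by
  obtain ⟨S, hS0, hS⟩ := exists_norm4_le
  refine ⟨3 * S + 1, by positivity, fun Ω p hp => ?_⟩
  refine le_of_pow_le_pow_left₀ (n := 4) (by norm_num) (by positivity) ((hS Ω p hp).trans ?_)
  have h1 : ∑ i, ‖p.2 i‖ ≤ 3 * ‖p‖ := by
    refine (Finset.sum_le_card_nsmul _ _ ‖p‖ fun i _ =>
      (norm_le_pi_norm p.2 i).trans (norm_snd_le p)).trans ?_
    simp
  calc ‖p.1‖ * (S * ∑ i, ‖p.2 i‖) ^ 3 ≤ ‖p‖ * (S * (3 * ‖p‖)) ^ 3 := by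
        gcongr
        exact norm_fst_le p
    _ ≤ ((3 * S + 1) * ‖p‖) * ((3 * S + 1) * ‖p‖) ^ 3 := by
        gcongr ?_ * ?_ ^ 3
        · nlinarith [norm_nonneg p]
        · nlinarith [norm_nonneg p]
    _ = _ := by ring

/-- The Ladyzhenskaya inequality in `V`. -/
theorem exists_norm4_vel_le : ∃ C : ℝ, 0 < C ∧ ∀ (Ω : Set E3) (w : V Ω),
    norm4 (vel w) ^ 4 ≤ C * (‖vel w‖ * norm1 w ^ 3) := by
  obtain ⟨S, hS0, hS⟩ := exists_norm4_le
  refine ⟨8 * S ^ 3 + 1, by positivity, fun Ω w => (hS Ω w.1 w.2.1).trans ?_⟩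
  have h0 := norm1_nonneg w
  calc ‖vel w‖ * (S * ∑ i, ‖w.1.2 i‖) ^ 3 ≤ ‖vel w‖ * (S * (2 * norm1 w)) ^ 3 := by
        gcongr
        exact sum_norm_snd_le w
    _ = 8 * S ^ 3 * (‖vel w‖ * norm1 w ^ 3) := by ring
    _ ≤ _ := by gcongr; linarith

/-- Both factors of the Ladyzhenskaya bound are dominated by the energy, so no Poincaré inequality
enters, at the price of a constant depending on `α`. Adding `1` again lets the constant be dominated
by its fourth power. -/
theorem exists_norm4_le_sqrt_alphaForm {α : ℝ} (hα : 0 < α) : ∃ K : ℝ, 0 ≤ K ∧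
    ∀ (Ω : Set E3) (w : V Ω), norm4 (vel w) ≤ K * Real.sqrt (alphaForm Ω α w w) := by
  obtain ⟨C, hC0, hC⟩ := exists_norm4_vel_le
  refine ⟨C * α⁻¹ ^ 3 + 1, by positivity, fun Ω w => ?_⟩
  refine le_of_pow_le_pow_left₀ (n := 4) (by norm_num) (by positivity) ((hC Ω w).trans ?_)
  have h0 := norm1_nonneg w
  set s := Real.sqrt (alphaForm Ω α w w)
  have hs : 0 ≤ s := Real.sqrt_nonneg _
  calc C * (‖vel w‖ * norm1 w ^ 3) ≤ C * (s * (α⁻¹ * s) ^ 3) := by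
        gcongr
        · exact norm_vel_le_sqrt α w
        · exact norm1_le_sqrt hα w
    _ = (C * α⁻¹ ^ 3) * s ^ 4 := by ring
    _ ≤ (C * α⁻¹ ^ 3 + 1) ^ 4 * s ^ 4 := by
        gcongr
        have : 0 ≤ C * α⁻¹ ^ 3 := by positivity
        calc C * α⁻¹ ^ 3 ≤ C * α⁻¹ ^ 3 + 1 := by linarith
          _ ≤ _ := le_self_pow₀ (by linarith) (by norm_num)
    _ = _ := by ring

end ladyzhenskaya

/-! ### Cancellation and bounds for `b` on `V` -/

section trilin

variable {Ω : Set E3}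

/-- `b(a, p, p) = 0` for `a ∈ H ∩ L⁴` and `p ∈ H₀¹`. -/
theorem convForm_self_eq_zero {a : L2 Ω} (ha : a ∈ H Ω) (ha4 : MemLp a 4 (volume.restrict Ω))
    {p : L2Jet Ω} (hp : p ∈ H01 Ω) : convForm a p.2 p.1 = 0 := by
  obtain ⟨K, hK0, hK⟩ := exists_norm4_le_norm
  -- The approximating test fields need not be divergence-free; only the transporting field `a` has
  -- to be. This is why the form is studied on jets in `H₀¹` and not on `V`.
  obtain ⟨s, hs, hlim⟩ := mem_closure_iff_seq_limit.1 hp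
  have hsH : ∀ n, s n ∈ H01 Ω := fun n => subset_closure (hs n)
  have hsum : ∀ q : L2Jet Ω, ∑ i, ‖q.2 i‖ ≤ 3 * ‖q‖ := fun q => by
    refine (Finset.sum_le_card_nsmul _ _ ‖q‖ fun i _ =>
      (norm_le_pi_norm q.2 i).trans (norm_snd_le q)).trans ?_
    simp
  -- Split `b(a, p, p) = b(a, p - sₙ, p) + b(a, sₙ, p - sₙ) + b(a, sₙ, sₙ)`; the last term is zero
  -- and the others are small with `p - sₙ`.
  have hbound : ∀ n, |convForm a p.2 p.1| ≤
      norm4 a * norm4 p.1 * (3 * ‖p - s n‖) + norm4 a * (K * ‖p - s n‖) * (3 * ‖s n‖) := by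
    intro n
    have hd : p - s n ∈ H01 Ω := sub_mem hp (hsH n)
    have e1 : convForm a (p - s n).2 p.1 = convForm a p.2 p.1 - convForm a (s n).2 p.1 :=
      convForm_sub_middle ha4 (memLp_four hp)
    have e2 : convForm a (s n).2 (p - s n).1 =
        convForm a (s n).2 p.1 - convForm a (s n).2 (s n).1 :=
      convForm_sub_right ha4 (memLp_four hp) (memLp_four (hsH n))
    rw [convForm_testJet_self ha (hs n)] at e2
    have e3 : convForm a p.2 p.1 =
        convForm a (p - s n).2 p.1 + convForm a (s n).2 (p - s n).1 := by linarith
    have ha0 := norm4_nonneg a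
    have hp0 := norm4_nonneg p.1
    have hd0 := norm4_nonneg (p - s n).1
    rw [e3]
    refine (abs_add_le _ _).trans (add_le_add ?_ ?_)
    · refine (abs_convForm_le ha4 (memLp_four hp) _).trans ?_
      gcongr
      exact hsum _
    · refine (abs_convForm_le ha4 (memLp_four hd) _).trans ?_
      gcongr
      · exact hK Ω _ hd
      · exact hsum _
  have hdiff : Tendsto (fun n => ‖p - s n‖) atTop (𝓝 0) := by
    have := (tendsto_const_nhds (x := p)).sub hlim
    simpa using this.norm
  have hz := ((hdiff.const_mul 3).const_mul (norm4 a * norm4 p.1)).add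
    (((hdiff.const_mul K).const_mul (norm4 a)).mul (hlim.norm.const_mul 3))
  simp only [mul_zero, zero_mul, add_zero] at hz
  exact abs_nonpos_iff.1 (ge_of_tendsto' hz hbound)

theorem memLp_four_vel (u : V Ω) : MemLp (vel u) 4 (volume.restrict Ω) := memLp_four u.2.1

theorem trilin_self_eq_zero (u w : V Ω) : trilin u w w = 0 := by
  rw [trilin_eq_convForm]
  exact convForm_self_eq_zero u.2.2 (memLp_four_vel u) w.2.1

theorem abs_trilin_le (u v w : V Ω) :
    |trilin u v w| ≤ norm4 (vel u) * norm4 (vel w) * (2 * norm1 v) := by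
  rw [trilin_eq_convForm]
  refine (abs_convForm_le (memLp_four_vel u) (memLp_four_vel w) _).trans ?_
  exact mul_le_mul_of_nonneg_left (sum_norm_snd_le v)
    (mul_nonneg (norm4_nonneg _) (norm4_nonneg _))

/-- The leftover term is `b(u, v - u, v - u) = 0`. Differentiation then falls on `v` alone, so that
an `H¹` bound on `v` suffices. -/
theorem trilin_sub_trilin (u v : V Ω) :
    trilin v v (v - u) - trilin u u (v - u) = trilin (v - u) v (v - u) := by
  have h1 : trilin (v - u) v (v - u) = trilin v v (v - u) - trilin u v (v - u) := by
    simp only [trilin_eq_convForm]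
    exact convForm_sub_left (memLp_four_vel v) (memLp_four_vel u) (memLp_four_vel (v - u))
  have h2 : trilin u (v - u) (v - u) = trilin u v (v - u) - trilin u u (v - u) := by
    simp only [trilin_eq_convForm]
    exact convForm_sub_middle (memLp_four_vel u) (memLp_four_vel (v - u))
  rw [trilin_self_eq_zero] at h2
  linarith

end trilin

/-! ### The dual norm `‖·‖₋₁` -/

section negativeNorm

variable {Ω : Set E3}

theorem exists_norm_vel_le (hΩ : Bornology.IsBounded Ω) :
    ∃ K : ℝ, 0 ≤ K ∧ ∀ w : V Ω, ‖vel w‖ ≤ K * norm1 w := by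
  obtain ⟨K, hK⟩ := exists_norm_fst_le hΩ
  refine ⟨K * 2, by positivity, fun w => (hK w.1 w.2.1).trans ?_⟩
  rw [mul_assoc]
  exact mul_le_mul_of_nonneg_left (sum_norm_snd_le w) K.coe_nonneg

/-- Homogeneity reduces to `‖φ‖₁ = 1`. The Poincaré inequality makes the supremum finite, and forces
the velocity to vanish when `‖φ‖₁ = 0`. -/
theorem abs_inner_le_normNeg1 (hΩ : Bornology.IsBounded Ω) (h : L2 Ω) (φ : V Ω) :
    |inner ℝ h (vel φ)| ≤ normNeg1 h * norm1 φ := by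
  obtain ⟨K, hK0, hK⟩ := exists_norm_vel_le hΩ
  have hbdd : BddAbove {a : ℝ | ∃ φ : V Ω, norm1 φ ≤ 1 ∧ a = |inner ℝ h (vel φ)|} := by
    refine ⟨‖h‖ * K, ?_⟩
    rintro a ⟨ψ, hψ, rfl⟩
    refine (abs_real_inner_le_norm _ _).trans ?_
    gcongr
    nlinarith [hK ψ]
  rcases (norm1_nonneg φ).eq_or_lt with h0 | h0
  · have : vel φ = 0 := by
      rw [← norm_le_zero_iff]
      simpa [← h0] using hK φ
    simp [this, ← h0]
  · have hmem : |inner ℝ h (vel ((norm1 φ)⁻¹ • φ))| ≤ normNeg1 h := by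
      refine le_csSup hbdd ⟨_, ?_, rfl⟩
      rw [norm1_smul, abs_of_pos (inv_pos.2 h0), inv_mul_cancel₀ h0.ne']
    rw [vel_smul, real_inner_smul_right, abs_mul, abs_of_pos (inv_pos.2 h0)] at hmem
    rwa [← div_le_iff₀ h0, div_eq_inv_mul]

end negativeNorm

/-! ### Energy estimates for one solution and for the difference -/

section energy

variable {Ω : Set E3} {α ν T : ℝ} {f : L2 Ω} {v₀ : V Ω} {v u : ℝ → V Ω}

/-- The inviscid model is the case `ν = 0`, so the bound on the right-hand side, valid for every
real `ν`, covers both equations. -/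
theorem IsBardinaSolution.isNSVSolution (hu : IsBardinaSolution Ω α T f v₀ u) :
    IsNSVSolution Ω α 0 T f v₀ u where
  cont := hu.cont
  init := hu.init
  eqn φ t ht := (hu.eqn φ t ht).congr_deriv (by ring)

theorem exists_bound_of_continuousOn {F : V Ω → ℝ} (hF : Continuous F)
    (hv : ContinuousOn v (Icc 0 T)) : ∃ M, 0 ≤ M ∧ ∀ t ∈ Icc (0 : ℝ) T, F (v t) ≤ M := by
  obtain ⟨M, hM⟩ := isCompact_Icc.bddAbove_image (hF.comp_continuousOn hv)
  exact ⟨max M 0, le_max_right _ _, fun t ht =>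
    (hM (mem_image_of_mem _ ht)).trans (le_max_left _ _)⟩

/-- The right-hand side of the equation is bounded in `V'`, uniformly in time. -/
theorem IsNSVSolution.exists_bound (hα : 0 < α) (hv : IsNSVSolution Ω α ν T f v₀ v) :
    ∃ M, ∀ t ∈ Icc (0 : ℝ) T, ∀ φ : V Ω,
      |inner ℝ (leray Ω f) (vel φ) - ν * gradInner (v t) φ - trilin (v t) (v t) φ| ≤
        M * Real.sqrt (alphaForm Ω α φ φ) := by
  obtain ⟨K, hK0, hK⟩ := exists_norm4_le_sqrt_alphaForm hα
  obtain ⟨M, hM0, hM⟩ := exists_bound_of_continuousOn continuous_norm1 hv.cont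
  have hE : Continuous fun w : V Ω => Real.sqrt (alphaForm Ω α w w) := by
    simp only [alphaForm_self]
    exact ((continuous_vel.norm.pow 2).add
      (continuous_const.mul (continuous_norm1.pow 2))).sqrt
  obtain ⟨N, hN0, hN⟩ := exists_bound_of_continuousOn hE hv.cont
  refine ⟨‖leray Ω f‖ + |ν| * (M * α⁻¹) + (K * N) * K * (2 * M), fun t ht φ => ?_⟩
  set s := Real.sqrt (alphaForm Ω α φ φ)
  have hs : 0 ≤ s := Real.sqrt_nonneg _
  have h1 : |inner ℝ (leray Ω f) (vel φ)| ≤ ‖leray Ω f‖ * s :=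
    (abs_real_inner_le_norm _ _).trans
      (mul_le_mul_of_nonneg_left (norm_vel_le_sqrt α φ) (norm_nonneg _))
  have h2 : |ν * gradInner (v t) φ| ≤ |ν| * (M * (α⁻¹ * s)) := by
    rw [abs_mul]
    refine mul_le_mul_of_nonneg_left ((abs_gradInner_le _ _).trans ?_) (abs_nonneg _)
    exact mul_le_mul (hM t ht) (norm1_le_sqrt hα φ) (norm1_nonneg _) hM0
  have h3 : |trilin (v t) (v t) φ| ≤ (K * N) * (K * s) * (2 * M) := by
    refine (abs_trilin_le _ _ _).trans ?_
    have := norm4_nonneg (vel (v t))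
    have := norm4_nonneg (vel φ)
    have := norm1_nonneg (v t)
    gcongr
    · exact (hK Ω (v t)).trans (mul_le_mul_of_nonneg_left (hN t ht) hK0)
    · exact hK Ω φ
    · exact hM t ht
  refine (abs_sub _ _).trans ((add_le_add (abs_sub _ _) le_rfl).trans ?_)
  calc _ ≤ ‖leray Ω f‖ * s + |ν| * (M * (α⁻¹ * s)) + (K * N) * (K * s) * (2 * M) :=
        add_le_add (add_le_add h1 h2) h3
    _ = _ := by ring

/-- The energy equality. -/
theorem IsNSVSolution.hasDerivWithinAt_energy (hα : 0 < α) (hv : IsNSVSolution Ω α ν T f v₀ v)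
    {t : ℝ} (ht : t ∈ Icc (0 : ℝ) T) :
    HasDerivWithinAt (fun s => alphaForm Ω α (v s) (v s))
      (2 * (inner ℝ (leray Ω f) (vel (v t)) - ν * norm1 (v t) ^ 2)) (Icc 0 T) t := by
  obtain ⟨M, hM⟩ := hv.exists_bound hα
  have h := hasDerivWithinAt_quadratic (alphaForm Ω α) (alphaForm_comm α)
    (alphaForm_self_nonneg α) v _ hv.eqn hM ht
  refine h.congr_deriv ?_
  rw [trilin_self_eq_zero, gradInner_self, sub_zero]

/-- The energy bound `‖v(t)‖₁² ≤ D_T e^T`. -/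
theorem IsNSVSolution.norm1_sq_le (hΩ : Bornology.IsBounded Ω) (hα : 0 < α) (hν : 0 ≤ ν)
    (hv : IsNSVSolution Ω α ν T f v₀ v) {t : ℝ} (ht : t ∈ Icc (0 : ℝ) T) :
    norm1 (v t) ^ 2 ≤ DT α T f v₀ * Real.exp T := by
  set N := normNeg1 (leray Ω f) with hN
  have hα2 : 0 < α ^ 2 := by positivity
  -- The viscous term is dropped by sign. Young's inequality `2N‖v‖₁ ≤ α⁻²N² + α²‖v‖₁²` leaves a
  -- term absorbed by the energy, hence the rate `K = 1` and the factor `e^T`.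
  have h := le_exp_mul_of_deriv_le (K := 1) (a := (α ^ 2)⁻¹ * N ^ 2) zero_le_one (by positivity)
    (fun s hs => hv.hasDerivWithinAt_energy hα hs) (fun s hs => by
      have h1 := (le_abs_self _).trans (abs_inner_le_normNeg1 hΩ (leray Ω f) (v s))
      rw [← hN] at h1
      have h2 : 2 * (N * norm1 (v s)) ≤ (α ^ 2)⁻¹ * N ^ 2 + α ^ 2 * norm1 (v s) ^ 2 := by
        have h3 := sq_nonneg (α⁻¹ * N - α * norm1 (v s))
        have h4 : (α⁻¹ * N - α * norm1 (v s)) ^ 2 =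
            (α ^ 2)⁻¹ * N ^ 2 + α ^ 2 * norm1 (v s) ^ 2 - 2 * (N * norm1 (v s)) := by
          field_simp
          ring
        linarith
      rw [alphaForm_self]
      nlinarith [mul_nonneg hν (sq_nonneg (norm1 (v s))), sq_nonneg ‖vel (v s)‖]) t ht
  simp only [hv.init, one_mul] at h
  have h5 : α ^ 2 * norm1 (v t) ^ 2 ≤ Real.exp T * (alphaForm Ω α v₀ v₀ + (α ^ 2)⁻¹ * N ^ 2 * T) :=
    calc α ^ 2 * norm1 (v t) ^ 2 ≤ alphaForm Ω α (v t) (v t) := by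
          rw [alphaForm_self]
          nlinarith [sq_nonneg ‖vel (v t)‖]
      _ ≤ _ := h
      _ ≤ _ := by
        have := alphaForm_self_nonneg α v₀
        have := ht.1
        gcongr
        · exact ht.2
        · exact ht.2
  rw [alphaForm_self] at h5
  unfold DT
  rw [← hN, mul_assoc, ← div_eq_inv_mul, le_div_iff₀ hα2]
  linarith

/-- The estimate of the difference of a Navier–Stokes–Voight solution and a Bardina solution, given
an estimate of `b(w, v, w)`. -/
theorem IsNSVSolution.alphaForm_sub_le (hΩ : Bornology.IsBounded Ω) (hα : 0 < α) (hν : 0 ≤ ν)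
    (hT : 0 ≤ T) (hv : IsNSVSolution Ω α ν T f v₀ v) (hu : IsBardinaSolution Ω α T f v₀ u)
    {κ : ℝ} (hκ0 : 0 ≤ κ)
    (hκ : ∀ w z : V Ω, 2 * |trilin w z w| ≤ κ * norm1 z * alphaForm Ω α w w)
    {t : ℝ} (ht : t ∈ Icc (0 : ℝ) T) :
    alphaForm Ω α (v t - u t) (v t - u t) ≤ ν ^ 2 * T * DT α T f v₀ * Real.exp T *
      Real.exp ((α ^ 2)⁻¹ * T + κ * T * Real.sqrt (DT α T f v₀) * Real.exp (T / 2)) := by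
  obtain ⟨M, hM⟩ := hv.exists_bound hα
  obtain ⟨M', hM'⟩ := hu.isNSVSolution.exists_bound hα
  set D := DT α T f v₀ with hD
  have hD0 : 0 ≤ D := by
    rw [hD]
    unfold DT
    positivity
  have hder : ∀ s ∈ Icc (0 : ℝ) T, HasDerivWithinAt
      (fun s => alphaForm Ω α (v s - u s) (v s - u s))
      (2 * (-(ν * gradInner (v s) (v s - u s)) - trilin (v s - u s) (v s) (v s - u s)))
      (Icc 0 T) s := by
    intro s hs
    have h := hasDerivWithinAt_quadratic (M := M + M') (alphaForm Ω α) (alphaForm_comm α)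
      (alphaForm_self_nonneg α) (fun s => v s - u s) _ (fun φ t ht => by
        have h1 := (hv.eqn φ t ht).sub (hu.isNSVSolution.eqn φ t ht)
        refine h1.congr_of_mem (fun s _ => ?_) ht
        simp only [map_sub, LinearMap.sub_apply, alphaForm_apply, Pi.sub_apply])
      (fun t ht φ => by
        refine (abs_sub _ _).trans ((add_le_add (hM t ht φ) (hM' t ht φ)).trans ?_)
        rw [add_mul]) hs
    refine h.congr_deriv ?_
    rw [← trilin_sub_trilin]
    ring
  have hnorm : ∀ s ∈ Icc (0 : ℝ) T, norm1 (v s) ≤ Real.sqrt D * Real.exp (T / 2) := by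
    intro s hs
    refine abs_le_of_sq_le_sq' ?_ (by positivity) |>.2
    rw [mul_pow, Real.sq_sqrt hD0, ← Real.exp_nat_mul]
    rw [show ((2 : ℕ) : ℝ) * (T / 2) = T by push_cast; ring]
    exact hv.norm1_sq_le hΩ hα hν hs
  -- In the rate `K`, `α⁻²` comes from `‖w‖₁²` in Young's inequality and the `κ` term from `b(w, v,
  -- w)`; the source `a` is the bound for `ν²‖v‖₁²`.
  have hgr := le_exp_mul_of_deriv_le
    (K := (α ^ 2)⁻¹ + κ * (Real.sqrt D * Real.exp (T / 2))) (a := ν ^ 2 * (D * Real.exp T))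
    (by positivity) (by positivity) hder (fun s hs => by
      set w := v s - u s
      have hw0 := alphaForm_self_nonneg α w
      have h1 : 2 * -(ν * gradInner (v s) w) ≤ ν ^ 2 * norm1 (v s) ^ 2 + norm1 w ^ 2 := by
        have h2 : -(ν * gradInner (v s) w) ≤ ν * (norm1 (v s) * norm1 w) := by
          rw [← mul_neg]
          exact mul_le_mul_of_nonneg_left ((neg_le_abs _).trans (abs_gradInner_le _ _)) hν
        nlinarith [sq_nonneg (ν * norm1 (v s) - norm1 w)]
      have h2 : ν ^ 2 * norm1 (v s) ^ 2 ≤ ν ^ 2 * (D * Real.exp T) :=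
        mul_le_mul_of_nonneg_left (hv.norm1_sq_le hΩ hα hν hs) (sq_nonneg _)
      have h3 : norm1 w ^ 2 ≤ (α ^ 2)⁻¹ * alphaForm Ω α w w := by
        rw [← div_eq_inv_mul, le_div_iff₀ (by positivity), alphaForm_self]
        nlinarith [sq_nonneg ‖vel w‖]
      have h4 : -(2 * trilin w (v s) w) ≤
          κ * (Real.sqrt D * Real.exp (T / 2)) * alphaForm Ω α w w := by
        have h5 := neg_le_abs (trilin w (v s) w)
        have h6 := hκ w (v s)
        have h7 : κ * norm1 (v s) * alphaForm Ω α w w ≤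
            κ * (Real.sqrt D * Real.exp (T / 2)) * alphaForm Ω α w w := by
          gcongr
          exact hnorm s hs
        linarith
      linarith) t ht
  simp only [hv.init, hu.init, sub_self, map_zero, zero_add] at hgr
  refine hgr.trans ?_
  have ht0 := ht.1
  calc Real.exp (((α ^ 2)⁻¹ + κ * (Real.sqrt D * Real.exp (T / 2))) * t) *
        (ν ^ 2 * (D * Real.exp T) * t)
      ≤ Real.exp (((α ^ 2)⁻¹ + κ * (Real.sqrt D * Real.exp (T / 2))) * T) *
        (ν ^ 2 * (D * Real.exp T) * T) := by
        gcongr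
        · exact ht.2
        · exact ht.2
    _ = _ := by
      rw [show ((α ^ 2)⁻¹ + κ * (Real.sqrt D * Real.exp (T / 2))) * T =
        (α ^ 2)⁻¹ * T + κ * T * Real.sqrt D * Real.exp (T / 2) by ring]
      ring

end energy

/-! ### Two bounds for `b(w, z, w)` -/

/-- `b(w, z, w)` is controlled by the form `(·, ·) + α² (∇·, ∇·)`. -/
theorem exists_trilin_le_alphaForm {α : ℝ} (hα : 0 < α) : ∃ κ : ℝ, 0 ≤ κ ∧
    ∀ (Ω : Set E3) (w z : V Ω), 2 * |trilin w z w| ≤ κ * norm1 z * alphaForm Ω α w w := by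
  obtain ⟨K, hK0, hK⟩ := exists_norm4_le_sqrt_alphaForm hα
  refine ⟨4 * K ^ 2, by positivity, fun Ω w z => ?_⟩
  have h := abs_trilin_le w z w
  have h1 : norm4 (vel w) * norm4 (vel w) ≤ K ^ 2 * alphaForm Ω α w w := by
    calc _ ≤ (K * Real.sqrt (alphaForm Ω α w w)) * (K * Real.sqrt (alphaForm Ω α w w)) :=
          mul_self_le_mul_self (norm4_nonneg _) (hK Ω w)
      _ = _ := by rw [mul_mul_mul_comm, Real.mul_self_sqrt (alphaForm_self_nonneg α w), sq]
  have h2 := mul_le_mul_of_nonneg_right h1 (norm1_nonneg z)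
  linarith

/-- `b(w, z, w)` is controlled by means of a Poincaré constant `l`. -/
theorem exists_trilin_le_of_poincare : ∃ C : ℝ, 0 < C ∧ ∀ (Ω : Set E3) (l : ℝ), 0 < l →
    (∀ w : V Ω, l * ‖vel w‖ ^ 2 ≤ norm1 w ^ 2) → ∀ α : ℝ, 0 < α → ∀ w z : V Ω,
      2 * |trilin w z w| ≤ C * (α ^ 2)⁻¹ * l ^ (-(1 / 4) : ℝ) * norm1 z * alphaForm Ω α w w := by
  obtain ⟨C, hC0, hC⟩ := exists_norm4_vel_le
  refine ⟨4 * Real.sqrt C, by positivity, fun Ω l hl hpoin α hα w z => ?_⟩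
  -- Here `‖w‖ ≤ l^{-1/2}‖w‖₁ = k²‖w‖₁`. Inserted in the Ladyzhenskaya inequality, this gives
  -- `‖w‖_{L⁴}² ≤ √C k ‖w‖₁²`, the source of the power `-1/4`.
  set k := l ^ (-(1 / 4) : ℝ) with hk
  have hk0 : 0 < k := Real.rpow_pos_of_pos hl _
  have hk4 : l * k ^ 4 = 1 := by
    rw [hk, ← Real.rpow_natCast, ← Real.rpow_mul hl.le]
    norm_num
    rw [Real.rpow_neg_one, mul_inv_cancel₀ hl.ne']
  have hw0 := norm1_nonneg w
  have hv : ‖vel w‖ ≤ k ^ 2 * norm1 w := by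
    refine abs_le_of_sq_le_sq' ?_ (by positivity) |>.2
    calc ‖vel w‖ ^ 2 = k ^ 4 * (l * ‖vel w‖ ^ 2) := by rw [← mul_assoc, mul_comm (k ^ 4), hk4, one_mul]
      _ ≤ k ^ 4 * norm1 w ^ 2 := mul_le_mul_of_nonneg_left (hpoin w) (by positivity)
      _ = _ := by ring
  have h4 : norm4 (vel w) * norm4 (vel w) ≤ Real.sqrt C * k * norm1 w ^ 2 := by
    refine abs_le_of_sq_le_sq' ?_ (by positivity) |>.2
    calc (norm4 (vel w) * norm4 (vel w)) ^ 2 = norm4 (vel w) ^ 4 := by ring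
      _ ≤ C * (‖vel w‖ * norm1 w ^ 3) := hC Ω w
      _ ≤ C * ((k ^ 2 * norm1 w) * norm1 w ^ 3) := by gcongr
      _ = Real.sqrt C ^ 2 * (k ^ 2 * norm1 w ^ 4) := by rw [Real.sq_sqrt hC0.le]; ring
      _ = _ := by ring
  have h3 : norm1 w ^ 2 ≤ (α ^ 2)⁻¹ * alphaForm Ω α w w := by
    rw [← div_eq_inv_mul, le_div_iff₀ (by positivity), alphaForm_self]
    nlinarith [sq_nonneg ‖vel w‖]
  have hz := norm1_nonneg z
  calc 2 * |trilin w z w| ≤ 4 * (norm4 (vel w) * norm4 (vel w)) * norm1 z := by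
        linarith [abs_trilin_le w z w]
    _ ≤ 4 * (Real.sqrt C * k * ((α ^ 2)⁻¹ * alphaForm Ω α w w)) * norm1 z := by
        refine mul_le_mul_of_nonneg_right (mul_le_mul_of_nonneg_left ?_ (by norm_num)) hz
        exact h4.trans (mul_le_mul_of_nonneg_left h3 (by positivity))
    _ = _ := by ring

/-! ### Rellich compactness by averaging over grid cells -/

/-- Jensen's inequality for the square of the norm. -/
theorem enorm_integral_sq_le {X F : Type*} [MeasurableSpace X] [NormedAddCommGroup F]
    [NormedSpace ℝ F] {μ : Measure X} [IsProbabilityMeasure μ] {f : X → F}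
    (hf : AEStronglyMeasurable f μ) : ‖∫ x, f x ∂μ‖ₑ ^ 2 ≤ ∫⁻ x, ‖f x‖ₑ ^ 2 ∂μ := by
  have h : ‖∫ x, f x ∂μ‖ₑ ≤ eLpNorm f 2 μ := by
    refine (enorm_integral_le_lintegral_enorm f).trans ?_
    rw [← eLpNorm_one_eq_lintegral_enorm]
    exact eLpNorm_le_eLpNorm_of_exponent_le (by norm_num) hf
  refine (pow_le_pow_left' h 2).trans (le_of_eq ?_)
  rw [eLpNorm_eq_lintegral_rpow_enorm_toReal (by norm_num) (by norm_num), ← ENNReal.rpow_natCast,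
    ← ENNReal.rpow_mul]
  norm_num

theorem eLpNorm_two_sq {X F : Type*} [MeasurableSpace X] [NormedAddCommGroup F]
    {μ : Measure X} (f : X → F) : eLpNorm f 2 μ ^ 2 = ∫⁻ x, ‖f x‖ₑ ^ 2 ∂μ := by
  rw [eLpNorm_eq_lintegral_rpow_enorm_toReal (by norm_num) (by norm_num), ← ENNReal.rpow_natCast,
    ← ENNReal.rpow_mul]
  norm_num

/-- The `L²` modulus of continuity of a test field. -/
theorem lintegral_sub_translate_le {Ω : Set E3} {φ : E3 → E3} (hφ : IsTestField Ω φ) (h : E3) :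
    ∫⁻ x, ‖φ x - φ (x + h)‖ₑ ^ 2 ≤ ‖h‖ₑ ^ 2 * eLpNorm (fderiv ℝ φ) 2 volume ^ 2 := by
  have hcf : Continuous (fderiv ℝ φ) := hφ.smooth.continuous_fderiv (by simp)
  have hprob : IsProbabilityMeasure (volume.restrict (Ioc (0 : ℝ) 1)) := ⟨by simp⟩
  -- Write the increment as the integral of the derivative along the segment and apply Jensen.
  -- Tonelli and translation invariance then remove the dependence on `t`.
  have hpt : ∀ x, ‖φ x - φ (x + h)‖ₑ ^ 2 ≤
      ∫⁻ t in Ioc (0 : ℝ) 1, ‖h‖ₑ ^ 2 * ‖fderiv ℝ φ (x + t • h)‖ₑ ^ 2 := by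
    intro x
    have hder : ∀ t : ℝ, HasDerivAt (fun t : ℝ => φ (x + t • h)) (fderiv ℝ φ (x + t • h) h) t := by
      intro t
      have h1 : HasDerivAt (fun t : ℝ => x + t • h) h t := by
        simpa using ((hasDerivAt_id t).smul_const h).const_add x
      exact (hφ.smooth.differentiable (by simp) _).hasFDerivAt.comp_hasDerivAt t h1
    have hcont : Continuous fun t : ℝ => fderiv ℝ φ (x + t • h) h :=
      (hcf.comp (by fun_prop)).clm_apply continuous_const
    have hftc := intervalIntegral.integral_eq_sub_of_hasDerivAt (fun t _ => hder t)
      (hcont.intervalIntegrable 0 1)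
    rw [intervalIntegral.integral_of_le zero_le_one, one_smul, zero_smul, add_zero] at hftc
    rw [← enorm_neg, neg_sub, ← hftc]
    refine (enorm_integral_sq_le hcont.aestronglyMeasurable).trans (lintegral_mono fun t => ?_)
    rw [← mul_pow, mul_comm]
    exact pow_le_pow_left' ((fderiv ℝ φ (x + t • h)).le_opENorm h) 2
  have hm : Measurable fun p : E3 × ℝ => ‖h‖ₑ ^ 2 * ‖fderiv ℝ φ (p.1 + p.2 • h)‖ₑ ^ 2 := by
    have : Continuous fun p : E3 × ℝ => fderiv ℝ φ (p.1 + p.2 • h) := hcf.comp (by fun_prop)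
    exact (this.enorm.measurable.pow_const 2).const_mul _
  calc ∫⁻ x, ‖φ x - φ (x + h)‖ₑ ^ 2
      ≤ ∫⁻ x, ∫⁻ t in Ioc (0 : ℝ) 1, ‖h‖ₑ ^ 2 * ‖fderiv ℝ φ (x + t • h)‖ₑ ^ 2 :=
        lintegral_mono hpt
    _ = ∫⁻ t in Ioc (0 : ℝ) 1, ∫⁻ x, ‖h‖ₑ ^ 2 * ‖fderiv ℝ φ (x + t • h)‖ₑ ^ 2 :=
        lintegral_lintegral_swap hm.aemeasurable
    _ = ∫⁻ _ in Ioc (0 : ℝ) 1, ‖h‖ₑ ^ 2 * eLpNorm (fderiv ℝ φ) 2 volume ^ 2 := by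
        refine lintegral_congr fun t => ?_
        rw [lintegral_const_mul _ (by
          exact ((hcf.comp (by fun_prop : Continuous fun x : E3 => x + t • h)).enorm.measurable).pow_const 2),
          lintegral_add_right_eq_self (fun x => ‖fderiv ℝ φ x‖ₑ ^ 2) (t • h), eLpNorm_two_sq]
    _ = _ := by simp

/-- The index of the cell of the grid of mesh `δ` that contains a point. -/
def cell (δ : ℝ) (x : E3) : Fin 3 → ℤ := fun i => ⌊x i / δ⌋

theorem measurable_cell (δ : ℝ) : Measurable (cell δ) :=
  measurable_pi_lambda _ fun i =>
    (((EuclideanSpace.proj (𝕜 := ℝ) i).continuous.measurable).div_const δ).floor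

theorem volume_cell {δ : ℝ} (hδ : 0 < δ) (z : Fin 3 → ℤ) :
    volume (cell δ ⁻¹' {z}) = ENNReal.ofReal (δ ^ 3) := by
  have h : cell δ ⁻¹' {z} = (MeasurableEquiv.toLp 2 (Fin 3 → ℝ)).symm ⁻¹'
      (pi univ fun i => Ico (z i * δ) ((z i + 1) * δ)) := by
    ext x
    simp only [mem_preimage, mem_singleton_iff, Set.mem_pi, mem_univ, true_implies, mem_Ico,
      funext_iff, cell, Int.floor_eq_iff, le_div_iff₀ hδ, div_lt_iff₀ hδ]
    rfl
  rw [h, (EuclideanSpace.volume_preserving_symm_measurableEquiv_toLp (Fin 3)).measure_preimage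
    (MeasurableSet.univ_pi fun i => measurableSet_Ico).nullMeasurableSet, Real.volume_pi_Ico,
    Fin.prod_univ_three]
  simp only [add_mul, one_mul, add_sub_cancel_left]
  rw [← ENNReal.ofReal_mul hδ.le, ← ENNReal.ofReal_mul (by positivity)]
  congr 1
  ring

theorem sub_mem_ball_of_cell_eq {δ : ℝ} (hδ : 0 < δ) {x y : E3} (h : cell δ y = cell δ x) :
    y - x ∈ Metric.ball (0 : E3) (2 * δ) := by
  have hi : ∀ i, (y i - x i) ^ 2 < δ ^ 2 := by
    intro i
    have h1 : |y i / δ - x i / δ| < 1 := Int.abs_sub_lt_one_of_floor_eq_floor (congrFun h i)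
    rw [← sub_div, abs_div, abs_of_pos hδ, div_lt_one hδ] at h1
    rw [sq_lt_sq, abs_of_pos hδ]
    exact h1
  rw [mem_ball_zero_iff, EuclideanSpace.norm_eq, Real.sqrt_lt' (by positivity),
    Fin.sum_univ_three]
  simp only [Real.norm_eq_abs, sq_abs, PiLp.sub_apply]
  nlinarith [hi 0, hi 1, hi 2, sq_nonneg δ]

theorem measurableSet_cell (δ : ℝ) (z : Fin 3 → ℤ) : MeasurableSet (cell δ ⁻¹' {z}) :=
  measurable_cell δ (measurableSet_singleton z)

/-- The average of a field over a cell of the grid. -/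
def cellAverage (δ : ℝ) (φ : E3 → E3) (z : Fin 3 → ℤ) : E3 :=
  ∫ y, φ y ∂(ProbabilityTheory.cond volume (cell δ ⁻¹' {z}))

/-- Jensen over the cell of `x`, which has volume `δ³` and lies in the ball of radius `2δ` about `x`
since its diameter is at most `√3 δ`. Enlarging to that ball makes the domain of the shifts
independent of `x`. -/
theorem enorm_sub_cellAverage_sq_le {δ : ℝ} (hδ : 0 < δ) {Ω : Set E3} {φ : E3 → E3}
    (hφ : IsTestField Ω φ) (x : E3) :
    ‖φ x - cellAverage δ φ (cell δ x)‖ₑ ^ 2 ≤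
      (ENNReal.ofReal (δ ^ 3))⁻¹ * ∫⁻ h in Metric.ball (0 : E3) (2 * δ), ‖φ x - φ (x + h)‖ₑ ^ 2 := by
  set Q := cell δ ⁻¹' {cell δ x} with hQ
  have hQm : MeasurableSet Q := measurableSet_cell δ _
  have hvol : volume Q = ENNReal.ofReal (δ ^ 3) := volume_cell hδ _
  have hprob : IsProbabilityMeasure (ProbabilityTheory.cond volume Q) :=
    ProbabilityTheory.cond_isProbabilityMeasure_of_finite
      (by rw [hvol]; exact (ENNReal.ofReal_pos.2 (by positivity)).ne')
      (by rw [hvol]; exact ENNReal.ofReal_ne_top)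
  have hint : Integrable φ (ProbabilityTheory.cond volume Q) :=
    memLp_one_iff_integrable.1 (hφ.memLp 1 _)
  have e : φ x - cellAverage δ φ (cell δ x) =
      ∫ y, (φ x - φ y) ∂(ProbabilityTheory.cond volume Q) := by
    rw [integral_sub (integrable_const _) hint, integral_const, probReal_univ, one_smul]
    rfl
  rw [e]
  refine (enorm_integral_sq_le (f := fun y => φ x - φ y)
    ((integrable_const _).sub hint).1).trans ?_
  rw [ProbabilityTheory.cond, lintegral_smul_measure, hvol, smul_eq_mul]
  refine mul_le_mul_right ?_ _
  have hball : MeasurableSet (Metric.ball (0 : E3) (2 * δ)) := measurableSet_ball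
  rw [← lintegral_indicator hQm, ← lintegral_indicator hball,
    ← lintegral_add_left_eq_self (fun y => Q.indicator (fun y => ‖φ x - φ y‖ₑ ^ 2) y) x]
  refine lintegral_mono fun h => ?_
  by_cases hh : x + h ∈ Q
  · have : h ∈ Metric.ball (0 : E3) (2 * δ) := by
      simpa using sub_mem_ball_of_cell_eq hδ (show cell δ (x + h) = cell δ x from hh)
    simp [hh, this]
  · simp [hh]

/-- After Tonelli each shift costs at most `(2δ)²` times the squared gradient norm; the constant is
`δ⁻³ · (2δ)² · (2δ)³ = 32δ²`. -/
theorem lintegral_sub_cellAverage_le {δ : ℝ} (hδ : 0 < δ) {Ω : Set E3} {φ : E3 → E3}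
    (hφ : IsTestField Ω φ) :
    ∫⁻ x, ‖φ x - cellAverage δ φ (cell δ x)‖ₑ ^ 2 ≤
      ENNReal.ofReal (32 * δ ^ 2) * volume (Metric.ball (0 : E3) 1) *
        eLpNorm (fderiv ℝ φ) 2 volume ^ 2 := by
  set G := eLpNorm (fderiv ℝ φ) 2 volume ^ 2
  have hm : Measurable fun p : E3 × E3 => ‖φ p.1 - φ (p.1 + p.2)‖ₑ ^ 2 := by
    have : Continuous fun p : E3 × E3 => φ p.1 - φ (p.1 + p.2) :=
      (hφ.continuous.comp continuous_fst).sub (hφ.continuous.comp (by fun_prop))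
    exact this.enorm.measurable.pow_const 2
  have hvol : volume (Metric.ball (0 : E3) (2 * δ)) =
      ENNReal.ofReal ((2 * δ) ^ 3) * volume (Metric.ball (0 : E3) 1) := by
    rw [Measure.addHaar_ball volume (0 : E3) (by positivity), finrank_E3]
  calc ∫⁻ x, ‖φ x - cellAverage δ φ (cell δ x)‖ₑ ^ 2
      ≤ ∫⁻ x, (ENNReal.ofReal (δ ^ 3))⁻¹ *
          ∫⁻ h in Metric.ball (0 : E3) (2 * δ), ‖φ x - φ (x + h)‖ₑ ^ 2 :=
        lintegral_mono fun x => enorm_sub_cellAverage_sq_le hδ hφ x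
    _ = (ENNReal.ofReal (δ ^ 3))⁻¹ *
          ∫⁻ x, ∫⁻ h in Metric.ball (0 : E3) (2 * δ), ‖φ x - φ (x + h)‖ₑ ^ 2 :=
        lintegral_const_mul _ hm.lintegral_prod_right'
    _ = (ENNReal.ofReal (δ ^ 3))⁻¹ *
          ∫⁻ h in Metric.ball (0 : E3) (2 * δ), ∫⁻ x, ‖φ x - φ (x + h)‖ₑ ^ 2 := by
        rw [lintegral_lintegral_swap hm.aemeasurable]
    _ ≤ (ENNReal.ofReal (δ ^ 3))⁻¹ *
          ∫⁻ _ in Metric.ball (0 : E3) (2 * δ), ENNReal.ofReal (2 * δ) ^ 2 * G := by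
        refine mul_le_mul_right (setLIntegral_mono measurable_const fun h hh => ?_) _
        refine (lintegral_sub_translate_le hφ h).trans (mul_le_mul_left (pow_le_pow_left' ?_ 2) _)
        rw [← ofReal_norm]
        exact ENNReal.ofReal_le_ofReal (mem_ball_zero_iff.1 hh).le
    _ = _ := by
        rw [setLIntegral_const, hvol, ← ENNReal.ofReal_inv_of_pos (by positivity),
          ← ENNReal.ofReal_pow (by positivity)]
        have : ENNReal.ofReal (32 * δ ^ 2) =
            ENNReal.ofReal ((δ ^ 3)⁻¹) * ENNReal.ofReal ((2 * δ) ^ 2) *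
              ENNReal.ofReal ((2 * δ) ^ 3) := by
          rw [← ENNReal.ofReal_mul (by positivity), ← ENNReal.ofReal_mul (by positivity)]
          congr 1
          field_simp
          norm_num
        rw [this]
        ring

section approximation

variable {Ω : Set E3}

theorem memLp_cellwise (hΩ : Bornology.IsBounded Ω) (δ : ℝ) (Z : Finset (Fin 3 → ℤ))
    (c : Z → E3) : MemLp (fun x => if h : cell δ x ∈ Z then c ⟨cell δ x, h⟩ else 0) 2
      (volume.restrict Ω) := by
  have : IsFiniteMeasure (volume.restrict Ω) := ⟨by simpa using hΩ.measure_lt_top⟩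
  refine MemLp.of_bound (C := ‖c‖) ?_ (Eventually.of_forall fun x => ?_)
  · exact ((Measurable.of_discrete (f := fun z : Fin 3 → ℤ =>
      if h : z ∈ Z then c ⟨z, h⟩ else 0)).comp (measurable_cell δ)).aestronglyMeasurable
  · split_ifs with h
    · exact norm_le_pi_norm c _
    · simp

/-- The fields that are constant on each of finitely many cells, and zero elsewhere. -/
def cellField (hΩ : Bornology.IsBounded Ω) (δ : ℝ) (Z : Finset (Fin 3 → ℤ)) :
    ((Z → E3) →ₗ[ℝ] L2 Ω) where
  toFun c := (memLp_cellwise hΩ δ Z c).toLp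
  map_add' c c' := by
    rw [← MemLp.toLp_add]
    congr 1
    funext x
    by_cases h : cell δ x ∈ Z <;> simp [h]
  map_smul' a c := by
    rw [RingHom.id_apply, ← MemLp.toLp_const_smul]
    congr 1
    funext x
    by_cases h : cell δ x ∈ Z <;> simp [h]

theorem coeFn_cellField (hΩ : Bornology.IsBounded Ω) (δ : ℝ) (Z : Finset (Fin 3 → ℤ))
    (c : Z → E3) : cellField hΩ δ Z c =ᵐ[volume.restrict Ω]
      fun x => if h : cell δ x ∈ Z then c ⟨cell δ x, h⟩ else 0 := by
  exact (memLp_cellwise hΩ δ Z c).coeFn_toLp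

theorem finite_image_cell (hΩ : Bornology.IsBounded Ω) {δ : ℝ} (hδ : 0 < δ) :
    (cell δ '' Ω).Finite := by
  obtain ⟨R, hR⟩ := hΩ.exists_norm_le
  refine (Set.Finite.pi' fun _ : Fin 3 => Set.finite_Icc ⌊-R / δ⌋ ⌊R / δ⌋).subset ?_
  rintro _ ⟨x, hx, rfl⟩ i
  have h := abs_le.1 ((PiLp.norm_apply_le x i).trans (hR x hx))
  exact ⟨Int.floor_le_floor (by gcongr; exact h.1), Int.floor_le_floor (by gcongr; exact h.2)⟩

/-- `H₀¹` fields are approximated by piecewise constant fields, uniformly on bounded sets. -/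
theorem exists_finiteDimensional_approx (hΩo : IsOpen Ω) (hΩ : Bornology.IsBounded Ω) {ε : ℝ}
    (hε : 0 < ε) : ∃ F : Submodule ℝ (L2 Ω), FiniteDimensional ℝ F ∧
      ∀ q ∈ testJets Ω, ∃ g ∈ F, ‖q.1 - g‖ ≤ ε * ‖q‖ := by
  set β := (volume (Metric.ball (0 : E3) 1)).toReal with hβ
  have hβ0 : 0 ≤ β := ENNReal.toReal_nonneg
  -- Chosen so that `32δ²β · 9 ≤ ε²`, by `32β ≤ (32β + 1)²`; the `+ 1` also keeps the denominator
  -- positive knowing only `β ≥ 0`.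
  set δ := ε / (3 * (32 * β + 1)) with hδdef
  have hδ : 0 < δ := by positivity
  set Z := (finite_image_cell hΩ hδ).toFinset
  refine ⟨LinearMap.range (cellField hΩ δ Z), inferInstance, fun q hq => ?_⟩
  obtain ⟨φ, hφ, h1, h2⟩ := hq
  refine ⟨cellField hΩ δ Z fun z => cellAverage δ φ z, LinearMap.mem_range_self _ _, ?_⟩
  have hsum : ∑ i, eLpNorm (partialD i φ) 2 (volume.restrict Ω) ≤ ENNReal.ofReal (3 * ‖q‖) := by
    have : ∀ i ∈ Finset.univ, eLpNorm (partialD i φ) 2 (volume.restrict Ω) ≤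
        ENNReal.ofReal ‖q‖ := by
      intro i _
      rw [← eLpNorm_congr_ae (h2 i), ← ENNReal.ofReal_toReal (Lp.eLpNorm_ne_top (q.2 i)),
        ← Lp.norm_def]
      exact ENNReal.ofReal_le_ofReal ((norm_le_pi_norm q.2 i).trans (norm_snd_le q))
    refine (Finset.sum_le_card_nsmul _ _ _ this).trans (le_of_eq ?_)
    rw [Finset.card_univ, Fintype.card_fin, nsmul_eq_mul, ENNReal.ofReal_mul (by norm_num)]
    simp
  have hG := hφ.eLpNorm_fderiv_le.trans hsum
  set r : L2 Ω := q.1 - cellField hΩ δ Z fun z => cellAverage δ φ z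
  have hae : r =ᵐ[volume.restrict Ω] fun x => φ x - cellAverage δ φ (cell δ x) := by
    filter_upwards [Lp.coeFn_sub q.1 (cellField hΩ δ Z fun z => cellAverage δ φ z), h1,
      coeFn_cellField hΩ δ Z fun z => cellAverage δ φ z, ae_restrict_mem hΩo.measurableSet]
      with x e1 e2 e3 hx
    have hZ : cell δ x ∈ Z := (finite_image_cell hΩ hδ).mem_toFinset.2 (mem_image_of_mem _ hx)
    rw [e1, Pi.sub_apply, e2, e3, dif_pos hZ]
  have hsq : eLpNorm r 2 (volume.restrict Ω) ^ 2 ≤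
      ENNReal.ofReal (32 * δ ^ 2 * β * (3 * ‖q‖) ^ 2) := by
    rw [eLpNorm_congr_ae hae, eLpNorm_two_sq]
    refine (setLIntegral_le_lintegral _ _).trans ((lintegral_sub_cellAverage_le hδ hφ).trans ?_)
    rw [ENNReal.ofReal_mul (p := 32 * δ ^ 2 * β) (by positivity),
      ENNReal.ofReal_mul (p := 32 * δ ^ 2) (by positivity),
      ENNReal.ofReal_pow (p := 3 * ‖q‖) (by positivity), hβ,
      ENNReal.ofReal_toReal measure_ball_lt_top.ne]
    gcongr
  have hreal : ‖r‖ ^ 2 ≤ 32 * δ ^ 2 * β * (3 * ‖q‖) ^ 2 := by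
    rw [Lp.norm_def, ← ENNReal.toReal_pow]
    exact ENNReal.toReal_le_of_le_ofReal (by positivity) hsq
  refine abs_le_of_sq_le_sq' (hreal.trans ?_) (by positivity) |>.2
  have hεδ : ε = 3 * (32 * β + 1) * δ := by rw [hδdef]; field_simp
  rw [hεδ]
  have h3 : 32 * β ≤ (32 * β + 1) ^ 2 := by nlinarith
  calc 32 * δ ^ 2 * β * (3 * ‖q‖) ^ 2 = (32 * β) * (δ ^ 2 * (3 * ‖q‖) ^ 2) := by ring
    _ ≤ (32 * β + 1) ^ 2 * (δ ^ 2 * (3 * ‖q‖) ^ 2) := by gcongr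
    _ = _ := by ring

/-- The Rellich–Kondrachov theorem: `H₀¹` of a bounded open set embeds compactly in `L²`. -/
theorem isCompactOperator_fst (hΩo : IsOpen Ω) (hΩ : Bornology.IsBounded Ω) :
    IsCompactOperator ((ContinuousLinearMap.fst ℝ (L2 Ω) (Fin 3 → L2 Ω)).comp (H01 Ω).subtypeL) := by
  set ι := (ContinuousLinearMap.fst ℝ (L2 Ω) (Fin 3 → L2 Ω)).comp (H01 Ω).subtypeL
  -- Compact operators form a norm-closed set, so it suffices to approximate the embedding by its
  -- finite-rank compositions with the orthogonal projection onto `F`, which is at least as close as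
  -- any chosen element of `F`.
  refine isClosed_setOfPred_isCompactOperator.closure_subset (Metric.mem_closure_iff.2 fun ε hε => ?_)
  obtain ⟨F, hF, hFapprox⟩ := exists_finiteDimensional_approx hΩo hΩ (half_pos hε)
  refine ⟨F.starProjection.comp ι, ?_, ?_⟩
  · have h1 : IsCompactOperator (F.orthogonalProjectionOnto.comp ι) :=
      isCompactOperator_of_locallyCompactSpace_dom (F.orthogonalProjectionOnto.comp ι)
    exact h1.clm_comp F.subtypeL
  · rw [dist_eq_norm]
    refine lt_of_le_of_lt (ContinuousLinearMap.opNorm_le_bound _ (half_pos hε).le ?_)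
      (half_lt_self hε)
    have hclosed : IsClosed {q : L2Jet Ω | ‖q.1 - F.starProjection q.1‖ ≤ ε / 2 * ‖q‖} :=
      isClosed_le (by fun_prop) (by fun_prop)
    intro p
    refine closure_minimal (fun q hq => ?_) hclosed p.2
    obtain ⟨g, hg, hqg⟩ := hFapprox q hq
    refine le_trans ?_ hqg
    rw [Submodule.starProjection_minimal]
    exact ciInf_le ⟨0, by rintro _ ⟨y, rfl⟩; exact norm_nonneg _⟩ (⟨g, hg⟩ : F)

end approximation

/-! ### The first Stokes eigenvalue as Poincaré constant -/

section eigenvalue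

variable {Ω : Set E3}

theorem isClosed_V (Ω : Set E3) : IsClosed (V Ω : Set (L2Jet Ω)) :=
  (testJets Ω).isClosed_topologicalClosure.inter
    ((solenoidalTest Ω).isClosed_topologicalClosure.preimage continuous_fst)

/-- A minimizer of the Rayleigh quotient is an eigenfunction of the Stokes operator. -/
theorem mem_stokesEigenvalues_of_minimizer {m : ℝ} {w : V Ω} (hw : vel w ≠ 0)
    (hm : ∀ φ : V Ω, m * ‖vel φ‖ ^ 2 ≤ norm1 φ ^ 2) (hwm : norm1 w ^ 2 = m * ‖vel w‖ ^ 2) :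
    m ∈ stokesEigenvalues Ω := by
  refine ⟨w, hw, (H Ω).smul_mem m w.2.2, fun φ => ?_⟩
  rw [real_inner_smul_left]
  set b := gradInner w φ - m * inner ℝ (vel w) (vel φ) with hb
  set c := norm1 φ ^ 2 - m * ‖vel φ‖ ^ 2 with hc
  have hc0 : 0 ≤ c := sub_nonneg.2 (hm φ)
  have hcomm : gradInner φ w = gradInner w φ := by
    rw [gradInner_eq_inner, real_inner_comm, ← gradInner_eq_inner]
  -- First variation: the function `‖·‖₁² - m‖·‖²` is nonnegative and vanishes at `w`, so its
  -- restriction to the line `w + tφ` has no linear term.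
  have key : ∀ t : ℝ, 0 ≤ 2 * t * b + t ^ 2 * c := by
    intro t
    have h := hm (w + t • φ)
    rw [← gradInner_self, gradInner_eq_inner, ← real_inner_self_eq_norm_sq] at h
    simp only [grad_add, grad_smul, vel_add, vel_smul, inner_add_left, inner_add_right,
      real_inner_smul_left, real_inner_smul_right] at h
    rw [← gradInner_eq_inner, ← gradInner_eq_inner, ← gradInner_eq_inner, ← gradInner_eq_inner,
      gradInner_self, gradInner_self, real_inner_self_eq_norm_sq, real_inner_self_eq_norm_sq,
      real_inner_comm (vel w) (vel φ), hcomm] at h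
    rw [hb, hc]
    linarith
  have hb0 : b = 0 := by
    -- The value `-b/c` would be optimal; `c + 1` avoids dividing by zero and still gives a negative
    -- value unless `b = 0`.
    have h := key (-b / (c + 1))
    have e : 2 * (-b / (c + 1)) * b + (-b / (c + 1)) ^ 2 * c =
        -(b ^ 2 * (c + 2)) / (c + 1) ^ 2 := by
      field_simp
      ring
    rw [e, le_div_iff₀ (by positivity), zero_mul] at h
    have h2 : b ^ 2 ≤ 0 := by nlinarith [sq_nonneg b, mul_nonneg (sq_nonneg b) hc0]
    exact pow_eq_zero_iff (two_ne_zero) |>.1 (le_antisymm h2 (sq_nonneg b))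
  linarith

/-- The infimum of the Rayleigh quotient is attained. -/
theorem exists_minimizer (hΩo : IsOpen Ω) (hΩ : Bornology.IsBounded Ω) (hne : ∃ w : V Ω, vel w ≠ 0) :
    ∃ (m : ℝ) (w : V Ω), vel w ≠ 0 ∧ norm1 w ^ 2 = m * ‖vel w‖ ^ 2 ∧
      ∀ φ : V Ω, m * ‖vel φ‖ ^ 2 ≤ norm1 φ ^ 2 := by
  set R : Set ℝ := {a | ∃ w : V Ω, ‖vel w‖ = 1 ∧ a = norm1 w ^ 2} with hR
  have hscale : ∀ φ : V Ω, vel φ ≠ 0 → (‖vel φ‖⁻¹) ^ 2 * norm1 φ ^ 2 ∈ R := by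
    intro φ hφ
    have h0 : 0 < ‖vel φ‖ := norm_pos_iff.2 hφ
    refine ⟨‖vel φ‖⁻¹ • φ, ?_, ?_⟩
    · rw [vel_smul, norm_smul, norm_inv, norm_norm, inv_mul_cancel₀ h0.ne']
    · rw [norm1_smul, mul_pow, sq_abs]
  have hRne : R.Nonempty := hne.elim fun w hw => ⟨_, hscale w hw⟩
  have hRbdd : BddBelow R := ⟨0, by rintro _ ⟨w, -, rfl⟩; positivity⟩
  set m := sInf R
  have hm : ∀ φ : V Ω, m * ‖vel φ‖ ^ 2 ≤ norm1 φ ^ 2 := by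
    intro φ
    by_cases hφ : vel φ = 0
    · rw [hφ, norm_zero]
      nlinarith [sq_nonneg (norm1 φ)]
    · have h0 : 0 < ‖vel φ‖ := norm_pos_iff.2 hφ
      have h := csInf_le hRbdd (hscale φ hφ)
      rwa [inv_pow, ← div_eq_inv_mul, le_div_iff₀ (by positivity)] at h
  obtain ⟨a, -, ha, haR⟩ := exists_seq_tendsto_sInf hRne hRbdd
  choose w hw1 hwa using haR
  obtain ⟨B, hB⟩ := ha.bddAbove_range
  have hcomp := (isCompactOperator_fst hΩo hΩ).isCompact_closure_image_closedBall (max 1 (1 + B))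
  have hgrad : ∀ n i, ‖(w n).1.2 i‖ ≤ 1 + B := by
    intro n i
    have h1 : a n ≤ B := hB (mem_range_self n)
    have h2 : ‖(w n).1.2 i‖ ≤ norm1 (w n) := by
      rw [norm1_eq_norm_grad]
      exact PiLp.norm_apply_le (grad (w n)) i
    rw [hwa n] at h1
    nlinarith [sq_nonneg (norm1 (w n) - 1), norm1_nonneg (w n)]
  have hmem : ∀ n, vel (w n) ∈ closure (((ContinuousLinearMap.fst ℝ (L2 Ω) (Fin 3 → L2 Ω)).comp
      (H01 Ω).subtypeL) '' Metric.closedBall 0 (max 1 (1 + B))) := by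
    intro n
    refine subset_closure ⟨⟨(w n).1, (w n).2.1⟩, ?_, rfl⟩
    rw [mem_closedBall_zero_iff]
    refine norm_prod_le_iff.2 ⟨(hw1 n).le.trans (le_max_left _ _), ?_⟩
    refine (pi_norm_le_iff_of_nonneg (zero_le_one.trans (le_max_left _ _))).2 fun i => ?_
    exact (hgrad n i).trans (le_max_right _ _)
  obtain ⟨g, -, k, hk, hg⟩ := hcomp.tendsto_subseq hmem
  have hg1 : ‖g‖ = 1 := by
    refine tendsto_nhds_unique hg.norm ?_
    simp only [Function.comp_apply, hw1]
    exact tendsto_const_nhds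
  have hak : Tendsto (fun n => a (k n)) atTop (𝓝 m) := ha.comp hk.tendsto_atTop
  -- Compactness gives strong convergence of the velocities only. For the gradients, the
  -- parallelogram law and the minimality of `m` bound the difference by a quantity tending to `4m -
  -- m‖2g‖² = 0`.
  have hpar : ∀ n l, ‖grad (w (k n)) - grad (w (k l))‖ ^ 2 ≤
      2 * a (k n) + 2 * a (k l) - m * ‖vel (w (k n)) + vel (w (k l))‖ ^ 2 := by
    intro n l
    have h1 := parallelogram_law_with_norm ℝ (grad (w (k n))) (grad (w (k l)))
    have h2 := hm (w (k n) + w (k l))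
    rw [vel_add, norm1_eq_norm_grad, grad_add] at h2
    rw [hwa, hwa, norm1_eq_norm_grad, norm1_eq_norm_grad]
    linarith
  have hlim : Tendsto (fun p : ℕ × ℕ => 2 * a (k p.1) + 2 * a (k p.2) -
      m * ‖vel (w (k p.1)) + vel (w (k p.2))‖ ^ 2) atTop (𝓝 0) := by
    rw [← prod_atTop_atTop_eq]
    have h1 := hak.comp (tendsto_fst (f := atTop) (g := (atTop : Filter ℕ)))
    have h2 := hak.comp (tendsto_snd (f := (atTop : Filter ℕ)) (g := atTop))
    have h3 := hg.comp (tendsto_fst (f := atTop) (g := (atTop : Filter ℕ)))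
    have h4 := hg.comp (tendsto_snd (f := (atTop : Filter ℕ)) (g := atTop))
    have h5 := ((h1.const_mul 2).add (h2.const_mul 2)).sub (((h3.add h4).norm.pow 2).const_mul m)
    have e : 2 * m + 2 * m - m * ‖g + g‖ ^ 2 = 0 := by
      rw [← two_smul ℝ g, norm_smul, hg1]
      norm_num
      ring
    rw [e] at h5
    exact h5
  have hcauchy : CauchySeq fun n => grad (w (k n)) := by
    rw [cauchySeq_iff_tendsto_dist_atTop_0]
    have h0 : Tendsto (fun p : ℕ × ℕ => ‖grad (w (k p.1)) - grad (w (k p.2))‖ ^ 2) atTop (𝓝 0) :=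
      squeeze_zero (fun p => by positivity) (fun p => hpar p.1 p.2) hlim
    have := h0.sqrt
    simpa only [Real.sqrt_sq (norm_nonneg _), Real.sqrt_zero, dist_eq_norm] using this
  obtain ⟨G, hG⟩ := cauchySeq_tendsto_of_complete hcauchy
  have hjet : Tendsto (fun n => (w (k n)).1) atTop (𝓝 ((g, G.ofLp) : L2Jet Ω)) :=
    hg.prodMk_nhds (((PiLp.continuous_ofLp 2 _).tendsto G).comp hG)
  have hV : ((g, G.ofLp) : L2Jet Ω) ∈ V Ω :=
    (isClosed_V Ω).mem_of_tendsto hjet (Eventually.of_forall fun n => (w (k n)).2)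
  refine ⟨m, ⟨_, hV⟩, ?_, ?_, hm⟩
  · change g ≠ 0
    rw [← norm_pos_iff, hg1]
    exact one_pos
  · change norm1 (⟨_, hV⟩ : V Ω) ^ 2 = m * ‖g‖ ^ 2
    rw [hg1, one_pow, mul_one, norm1_eq_norm_grad]
    refine tendsto_nhds_unique (hG.norm.pow 2) ?_
    refine hak.congr fun n => ?_
    rw [hwa, norm1_eq_norm_grad]

/-- The Poincaré inequality with the first eigenvalue of the Stokes operator. -/
theorem poincare_of_isLeast (hΩo : IsOpen Ω) (hΩ : Bornology.IsBounded Ω) {l : ℝ}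
    (hl : IsLeast (stokesEigenvalues Ω) l) :
    0 < l ∧ ∀ w : V Ω, l * ‖vel w‖ ^ 2 ≤ norm1 w ^ 2 := by
  obtain ⟨⟨e, he, -, heq⟩, hmin⟩ := hl
  have he0 : 0 < ‖vel e‖ := norm_pos_iff.2 he
  refine ⟨?_, fun w => ?_⟩
  · obtain ⟨K, hK0, hK⟩ := exists_norm_vel_le hΩ
    have h1 := heq e
    rw [gradInner_self, real_inner_smul_left, real_inner_self_eq_norm_sq] at h1
    have h2 : 0 < norm1 e := pos_of_mul_pos_right (he0.trans_le (hK e)) hK0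
    exact pos_of_mul_pos_left (h1 ▸ pow_pos h2 2) (sq_nonneg _)
  -- The minimum `m` is itself an eigenvalue, so the least eigenvalue `l` cannot exceed it.
  · obtain ⟨m, z, hz, hzm, hm⟩ := exists_minimizer hΩo hΩ ⟨e, he⟩
    have hlm : l ≤ m := hmin (mem_stokesEigenvalues_of_minimizer hz hm hzm)
    exact (mul_le_mul_of_nonneg_right hlm (sq_nonneg _)).trans (hm w)

end eigenvalue

end NSV
end

/-! ### The main theorem -/

theorem mainTheorem6 (Ω : Set NSV.E3) (hΩo : IsOpen Ω) (hΩc : IsConnected Ω)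
    (hΩb : Bornology.IsBounded Ω) :
    -- the estimate, with one constant `C` for all dilates `r • Ω` of the domain
    (∃ C : ℝ, 0 < C ∧ ∀ r : ℝ, 0 < r →
      ∀ lam1 : ℝ, IsLeast (NSV.stokesEigenvalues (r • Ω)) lam1 →
      ∀ α ν T : ℝ, 0 < α → 0 < ν → 0 < T →
      ∀ (f : NSV.L2 (r • Ω)) (v₀ : NSV.V (r • Ω)) (v u : ℝ → NSV.V (r • Ω)),
        NSV.IsNSVSolution (r • Ω) α ν T f v₀ v →
        NSV.IsBardinaSolution (r • Ω) α T f v₀ u →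
        ∀ t ∈ Icc (0 : ℝ) T,
          ‖NSV.vel (v t - u t)‖ ^ 2 + α ^ 2 * NSV.norm1 (v t - u t) ^ 2 ≤
            ν ^ 2 * T * NSV.DT α T f v₀ * Real.exp T *
              Real.exp ((α ^ 2)⁻¹ * T +
                C * (α ^ 2)⁻¹ * lam1 ^ (-(1 / 4) : ℝ) * T *
                  Real.sqrt (NSV.DT α T f v₀) * Real.exp (T / 2))) ∧
    -- convergence in `V`, uniformly on `[0, T]`, as `ν → 0⁺`
    (∀ α T : ℝ, 0 < α → 0 < T →
      ∀ (f : NSV.L2 Ω) (v₀ : NSV.V Ω) (u : ℝ → NSV.V Ω),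
        NSV.IsBardinaSolution Ω α T f v₀ u →
        ∀ ε : ℝ, 0 < ε → ∀ᶠ ν in 𝓝[>] (0 : ℝ), ∀ v : ℝ → NSV.V Ω,
          NSV.IsNSVSolution Ω α ν T f v₀ v →
          ∀ t ∈ Icc (0 : ℝ) T, NSV.norm1 (v t - u t) < ε) := by
  constructor
  -- The constant is fixed before `r`, and indeed before the domain.
  · obtain ⟨C, hC0, hC⟩ := NSV.exists_trilin_le_of_poincare
    refine ⟨C, hC0, fun r hr lam1 hlam α ν T hα hν hT f v₀ v u hv hu t ht => ?_⟩
    have hb : Bornology.IsBounded (r • Ω) := hΩb.smul₀ r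
    obtain ⟨hl0, hpoin⟩ := NSV.poincare_of_isLeast (hΩo.smul₀ hr.ne') hb hlam
    have h := hv.alphaForm_sub_le hb hα hν.le hT.le hu (by positivity) (hC _ lam1 hl0 hpoin α hα) ht
    rwa [NSV.alphaForm_self] at h
  · intro α T hα hT f v₀ u hu ε hε
    -- With `α` fixed, a constant depending on `α` is enough. This bound avoids `λ₁`, so the
    -- convergence does not require the existence of a first eigenvalue.
    obtain ⟨κ, hκ0, hκ⟩ := NSV.exists_trilin_le_alphaForm hα
    set c := T * NSV.DT α T f v₀ * Real.exp T * Real.exp ((α ^ 2)⁻¹ * T +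
      κ * T * Real.sqrt (NSV.DT α T f v₀) * Real.exp (T / 2)) with hc
    have hlim : Tendsto (fun ν : ℝ => ν ^ 2 * c) (𝓝[>] 0) (𝓝 0) := by
      have h : Continuous fun ν : ℝ => ν ^ 2 * c := by fun_prop
      simpa using (h.tendsto 0).mono_left nhdsWithin_le_nhds
    filter_upwards [hlim.eventually_lt_const (show 0 < α ^ 2 * ε ^ 2 by positivity),
      self_mem_nhdsWithin] with ν hνc hν v hv t ht
    have h := hv.alphaForm_sub_le hΩb hα (le_of_lt hν) hT.le hu hκ0 (hκ Ω) ht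
    rw [NSV.alphaForm_self] at h
    have h2 : α ^ 2 * NSV.norm1 (v t - u t) ^ 2 < α ^ 2 * ε ^ 2 := by
      refine lt_of_le_of_lt ?_ hνc
      rw [hc]
      nlinarith [sq_nonneg ‖NSV.vel (v t - u t)‖]
    exact lt_of_pow_lt_pow_left₀ 2 hε.le (lt_of_mul_lt_mul_left h2 (sq_nonneg α))
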